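/- All vector spaces are over a field $K$ of characteristic zero, all graded vector spaces are $\mathbb Z$-graded, and in exponents of $-1$ a homogeneous element stands for its degree. For a graded vector space $V$, $(sV)^i=V^{i-1}$ and $(s^{-1}V)^i=V^{i+1}$; the maps $s:V\to sV$ and $s^{-1}:V\to s^{-1}V$ are the identity on underlying vectors. A symmetric graded Lie algebra is a graded vector space $\mathfrak g$ with a bilinear bracket of degree $1$ such that, for homogeneous elements, $$[x,y]_{\mathfrak g}=(-1)^{xy}[y,x]_{\mathfrak g},\qquad [x,[y,z]_{\mathfrak g}]_{\mathfrak g}=(-1)^{x+1}[[x,y]_{\mathfrak g},z]_{\mathfrak g}+(-1)^{(x+1)(y+1)}[y,[x,z]_{\mathfrak g}]_{\mathfrak g}.$$ A derivation of degree $n$ of a symmetric graded Lie algebra $\mathfrak h$ is a linear map $D:\mathfrak h\to\mathfrak h$ of degree $n$ with $D[x,y]_{\mathfrak h}=(-1)^n[Dx,y]_{\mathfrak h}+(-1)^{n(x+1)}[x,Dy]_{\mathfrak h}$; these form $\mathrm{Der}^n(\mathfrak h)$, and $\mathrm{Der}(\mathfrak h)=\bigoplus_n\mathrm{Der}^n(\mathfrak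 h)$ carries the graded commutator $[D,E]=DE-(-1)^{DE}ED$. The space $s^{-1}\mathrm{Der}(\mathfrak h)$ is a symmetric graded Lie algebra with bracket $[s^{-1}D,s^{-1}E]=(-1)^{D}s^{-1}[D,E]$. An action of $\mathfrak g$ on $\mathfrak h$ is a linear map $\rho:\mathfrak g\to\mathrm{Der}(\mathfrak h)$ of degree $1$ such that $s^{-1}\circ\rho:\mathfrak g\to s^{-1}\mathrm{Der}(\mathfrak h)$ is a homomorphism of symmetric graded Lie algebras. $S(\mathfrak h)=\bigoplus_{k\ge0} S^k(\mathfrak h)$ is the graded symmetric algebra. The Koszul sign $\varepsilon(\sigma)=\varepsilon(\sigma;v_1,\dots,v_p)$ is defined by $v_1\odot\cdots\odot v_p=\varepsilon(\sigma)\,v_{\sigma(1)}\odot\cdots\odot v_{\sigma(p)}$. $\mathrm{Hom}^n(S(\mathfrak h),W)$ is the space of linear maps of degree $n$; its elements are written $f=\sum_{k\ge 0} f_k$ with $f_k:S^k(\mathfrak h)\to W$. $\mathbb S_{(i_1,\dots,i_r)}$ is the set of $(i_1,\dots,i_r)$-shuffles (empty if some $i_j<0$). Let $\mathfrak g$ and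 $\mathfrak h$ be symmetric graded Lie algebras and $\rho:\mathfrak g\to \mathrm{Der}(\mathfrak h)$ an action. Let $C^n(\mathfrak h,\mathfrak g)=\mathrm{Hom}^n(S(\mathfrak h),\mathfrak g)$ and $C^*(\mathfrak h,\mathfrak g)=\bigoplus_n C^n(\mathfrak h,\mathfrak g)$. For $f\in C^m(\mathfrak h,\mathfrak g)$, $g\in C^n(\mathfrak h,\mathfrak g)$ and homogeneous $v_1,\dots,v_p\in\mathfrak h$ put $$(\mathrm d g)_p(v_1,\dots,v_p)=\sum_{1\le i<j\le p}(-1)^{n+1+v_i(v_1+\cdots+v_{i-1})+v_j(v_1+\cdots+v_{j-1})+v_iv_j}\,g_{p-1}([v_i,v_j]_{\mathfrak h},v_1,\dots,\hat v_i,\dots,\hat v_j,\dots,v_p),$$ $$\begin{aligned}[\![f,g]\!]_p(v_1,\dots,v_p)=&-\sum_{k+l=p+1}\ \sum_{\sigma\in\mathbb S_{(l,1,p-l-1)}}\varepsilon(\sigma) f_{k-1}\big(\rho(g_l(v_{\sigma(1)},\dots,v_{\sigma(l)}))v_{\sigma(l+1)},v_{\sigma(l+2)},\dots,v_{\sigma(p)}\big)\\&+(-1)^{(m+1)(n+1)}\sum_{k+l=p+1}\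 \sum_{\sigma\in\mathbb S_{(k-1,1,p-k)}}\varepsilon(\sigma) g_{l}\big(\rho(f_{k-1}(v_{\sigma(1)},\dots,v_{\sigma(k-1)}))v_{\sigma(k)},v_{\sigma(k+1)},\dots,v_{\sigma(p)}\big)\\&-\sum_{k+l=p+1}\ \sum_{\sigma\in\mathbb S_{(k-1,l)}}(-1)^{n(v_{\sigma(1)}+\cdots+v_{\sigma(k-1)})+m+1}\varepsilon(\sigma)[f_{k-1}(v_{\sigma(1)},\dots,v_{\sigma(k-1)}),g_l(v_{\sigma(k)},\dots,v_{\sigma(p)})]_{\mathfrak g},\end{aligned}$$ where $k\ge1$ and $l\ge0$. Let $\bar{\mathcal C}^n(\mathfrak h,\mathfrak h)=\mathrm{Hom}^n(S(\mathfrak h),s^{-1}\mathrm{Der}(\mathfrak h))$ and $\bar{\mathcal C}^*(\mathfrak h,\mathfrak h)=\bigoplus_n\bar{\mathcal C}^n(\mathfrak h,\mathfrak h)$. Define $\partial$ on $\bar{\mathcal C}^n(\mathfrak h,\mathfrak h)$ by the same formula as $\mathrm d$, and for $\alpha\in\bar{\mathcal C}^m(\mathfrak h,\mathfrak h)$, $\beta\in\bar{\mathcal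 C}^n(\mathfrak h,\mathfrak h)$ put $$\begin{aligned}[\alpha,\beta]^c_p(v_1,\dots,v_p)=&-\sum_{k+l=p+1}\ \sum_{\sigma\in\mathbb S_{(l,1,p-l-1)}}\varepsilon(\sigma) \alpha_{k-1}\big(s(\beta_l(v_{\sigma(1)},\dots,v_{\sigma(l)}))v_{\sigma(l+1)},v_{\sigma(l+2)},\dots,v_{\sigma(p)}\big)\\&+(-1)^{(m+1)(n+1)}\sum_{k+l=p+1}\ \sum_{\sigma\in\mathbb S_{(k-1,1,p-k)}}\varepsilon(\sigma) \beta_{l}\big(s(\alpha_{k-1}(v_{\sigma(1)},\dots,v_{\sigma(k-1)}))v_{\sigma(k)},v_{\sigma(k+1)},\dots,v_{\sigma(p)}\big)\\&-\sum_{k+l=p+1}\ \sum_{\sigma\in\mathbb S_{(k-1,l)}}(-1)^{(n+1)(v_{\sigma(1)}+\cdots+v_{\sigma(k-1)})}\varepsilon(\sigma)\,s^{-1}[s\alpha_{k-1}(v_{\sigma(1)},\dots,v_{\sigma(k-1)}),s\beta_l(v_{\sigma(k)},\dots,v_{\sigma(p)})].\end{aligned}$$ Theorem. $(sC^*(\mathfrak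 h,\mathfrak g),[\![\cdot,\cdot]\!],\mathrm d)$ and $(s\bar{\mathcal C}^*(\mathfrak h,\mathfrak h),[\cdot,\cdot]^c,\partial)$ are differential graded Lie algebras, and the linear map of degree $0$ $$\Psi:C^*(\mathfrak h,\mathfrak g)\to\bar{\mathcal C}^*(\mathfrak h,\mathfrak h),\qquad \Psi(f)_k=s^{-1}\circ\rho\circ f_k,$$ is a homomorphism of differential graded Lie algebras from $(sC^*(\mathfrak h,\mathfrak g),[\![\cdot,\cdot]\!],\mathrm d)$ to $(s\bar{\mathcal C}^*(\mathfrak h,\mathfrak h),[\cdot,\cdot]^c,\partial)$: it respects degrees, $\Psi([\![f,g]\!])=[\Psi(f),\Psi(g)]^c$ and $\Psi(\mathrm d f)=\partial\Psi(f)$. -/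

import Mathlib

/-!
Graded vector spaces over a field `K` are internally graded: a `K`-module `V` with a family
`𝒱 : ℤ → Submodule K V` of homogeneous components (`DirectSum.Decomposition 𝒱` says that `V` is
their direct sum).  The sign `(-1)^n`, `n : ℤ`, is the integer power of `-1` in the field `K`.
-/

namespace HomotopyLie

open Finset

/-! ### Differential graded Lie algebras -/

/-- The data underlying a differential graded Lie algebra `L = ⨁ₙ L^n`: the components
`L^n = comp n` are subspaces of one ambient vector space `A`, `bracket m n` is the bracket
`L^m × L^n → L^{m+n}` and `diff n` is the differential `L^n → L^{n+1}`
(only their values on the components matter). -/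
structure DGLieData (K A : Type*) [Field K] [AddCommGroup A] [Module K A] where
  comp : ℤ → Submodule K A
  bracket : ℤ → ℤ → A → A → A
  diff : ℤ → A → A

section DGLie

variable {K A B : Type*} [Field K] [AddCommGroup A] [Module K A] [AddCommGroup B] [Module K B]

/-- `L` is a differential graded Lie algebra. -/
structure DGLieData.IsDGLA (L : DGLieData K A) : Prop where
  bracket_mem : ∀ {m n : ℤ} {x y : A}, x ∈ L.comp m → y ∈ L.comp n →
    L.bracket m n x y ∈ L.comp (m + n)
  bracket_add_left : ∀ {m n : ℤ} {x x' y : A}, x ∈ L.comp m → x' ∈ L.comp m → y ∈ L.comp n →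
    L.bracket m n (x + x') y = L.bracket m n x y + L.bracket m n x' y
  bracket_smul_left : ∀ {m n : ℤ} (c : K) {x y : A}, x ∈ L.comp m → y ∈ L.comp n →
    L.bracket m n (c • x) y = c • L.bracket m n x y
  bracket_add_right : ∀ {m n : ℤ} {x y y' : A}, x ∈ L.comp m → y ∈ L.comp n → y' ∈ L.comp n →
    L.bracket m n x (y + y') = L.bracket m n x y + L.bracket m n x y'
  bracket_smul_right : ∀ {m n : ℤ} (c : K) {x y : A}, x ∈ L.comp m → y ∈ L.comp n →
    L.bracket m n x (c • y) = c • L.bracket m n x y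
  bracket_skew : ∀ {m n : ℤ} {x y : A}, x ∈ L.comp m → y ∈ L.comp n →
    L.bracket m n x y = -((-1 : K) ^ (m * n) • L.bracket n m y x)
  jacobi : ∀ {m n k : ℤ} {x y z : A}, x ∈ L.comp m → y ∈ L.comp n → z ∈ L.comp k →
    L.bracket m (n + k) x (L.bracket n k y z) =
      L.bracket (m + n) k (L.bracket m n x y) z +
        (-1 : K) ^ (m * n) • L.bracket n (m + k) y (L.bracket m k x z)
  diff_mem : ∀ {n : ℤ} {x : A}, x ∈ L.comp n → L.diff n x ∈ L.comp (n + 1)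
  diff_add : ∀ {n : ℤ} {x x' : A}, x ∈ L.comp n → x' ∈ L.comp n →
    L.diff n (x + x') = L.diff n x + L.diff n x'
  diff_smul : ∀ {n : ℤ} (c : K) {x : A}, x ∈ L.comp n → L.diff n (c • x) = c • L.diff n x
  diff_diff : ∀ {n : ℤ} {x : A}, x ∈ L.comp n → L.diff (n + 1) (L.diff n x) = 0
  diff_bracket : ∀ {m n : ℤ} {x y : A}, x ∈ L.comp m → y ∈ L.comp n →
    L.diff (m + n) (L.bracket m n x y) =
      L.bracket (m + 1) n (L.diff m x) y + (-1 : K) ^ m • L.bracket m (n + 1) x (L.diff n y)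

/-- `Φ` is a homomorphism of differential graded Lie algebras from `L` to `L'`: both are
differential graded Lie algebras, and `Φ` is linear of degree `0` and commutes with brackets and
differentials. -/
structure IsDGLAHom (L : DGLieData K A) (L' : DGLieData K B) (Φ : A →ₗ[K] B) : Prop where
  source : L.IsDGLA
  target : L'.IsDGLA
  map_mem : ∀ {n : ℤ} {x : A}, x ∈ L.comp n → Φ x ∈ L'.comp n
  map_bracket : ∀ {m n : ℤ} {x y : A}, x ∈ L.comp m → y ∈ L.comp n →
    Φ (L.bracket m n x y) = L'.bracket m n (Φ x) (Φ y)
  map_diff : ∀ {n : ℤ} {x : A}, x ∈ L.comp n → Φ (L.diff n x) = L'.diff n (Φ x)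

end DGLie

/-! ### Symmetric graded Lie algebras, derivations, actions -/

/-- A symmetric graded Lie algebra structure on the graded vector space `(V, 𝒱)`. -/
structure SymGradedLie (K : Type*) {V : Type*} [Field K] [AddCommGroup V] [Module K V]
    (𝒱 : ℤ → Submodule K V) where
  bracket : V →ₗ[K] V →ₗ[K] V
  bracket_mem : ∀ {i j : ℤ} {x y : V}, x ∈ 𝒱 i → y ∈ 𝒱 j → bracket x y ∈ 𝒱 (i + j + 1)
  bracket_symm : ∀ {i j : ℤ} {x y : V}, x ∈ 𝒱 i → y ∈ 𝒱 j →
    bracket x y = (-1 : K) ^ (i * j) • bracket y x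
  leibniz : ∀ {i j k : ℤ} {x y z : V}, x ∈ 𝒱 i → y ∈ 𝒱 j → z ∈ 𝒱 k →
    bracket x (bracket y z) = (-1 : K) ^ (i + 1) • bracket (bracket x y) z +
      (-1 : K) ^ ((i + 1) * (j + 1)) • bracket y (bracket x z)

section Action

variable {K G H : Type*} [Field K] [AddCommGroup G] [Module K G] [AddCommGroup H] [Module K H]
  {𝒢 : ℤ → Submodule K G} {ℋ : ℤ → Submodule K H}

/-- `Der^n(𝔥)`: the derivations of degree `n` of the symmetric graded Lie algebra `𝔥`. -/
def der (𝔥 : SymGradedLie K ℋ) (n : ℤ) : Submodule K (Module.End K H) where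
  carrier := {D | (∀ i, ∀ x ∈ ℋ i, D x ∈ ℋ (i + n)) ∧
    ∀ i j, ∀ x ∈ ℋ i, ∀ y ∈ ℋ j, D (𝔥.bracket x y) =
      (-1 : K) ^ n • 𝔥.bracket (D x) y + (-1 : K) ^ (n * (i + 1)) • 𝔥.bracket x (D y)}
  add_mem' := by
    rintro D E ⟨hD, hD'⟩ ⟨hE, hE'⟩
    refine ⟨fun i x hx => add_mem (hD i x hx) (hE i x hx), fun i j x hx y hy => ?_⟩
    simp only [LinearMap.add_apply, hD' i j x hx y hy, hE' i j x hx y hy, map_add, smul_add]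
    abel
  zero_mem' := by
    refine ⟨fun i x _ => by simp, fun i j x _ y _ => by simp⟩
  smul_mem' := by
    rintro c D ⟨hD, hD'⟩
    refine ⟨fun i x hx => Submodule.smul_mem _ c (hD i x hx), fun i j x hx y hy => ?_⟩
    simp only [LinearMap.smul_apply, hD' i j x hx y hy, map_smul, smul_add, smul_comm c]

/-- The components `(s⁻¹Der(𝔥))^n = Der^{n+1}(𝔥)` of the desuspension of `Der(𝔥)`; the maps
`s` and `s⁻¹` are the identity on underlying vectors. -/
def desuspDer (𝔥 : SymGradedLie K ℋ) (n : ℤ) : Submodule K (Module.End K H) :=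
  der 𝔥 (n + 1)

/-- The graded commutator `[D, E] = D ∘ E - (-1)^{mn} E ∘ D` of endomorphisms of degrees `m` and
`n`, as a bilinear map. -/
def gradedCommutator (K H : Type*) [Field K] [AddCommGroup H] [Module K H] (m n : ℤ) :
    Module.End K H →ₗ[K] Module.End K H →ₗ[K] Module.End K H :=
  LinearMap.mul K (Module.End K H) -
    (-1 : K) ^ (m * n) • (LinearMap.mul K (Module.End K H)).flip

/-- `ρ : 𝔤 → Der(𝔥)` is an action: it has degree `1` and `s⁻¹ ∘ ρ` is a homomorphism of symmetric
graded Lie algebras from `𝔤` to `s⁻¹Der(𝔥)`, whose bracket is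
`[s⁻¹D, s⁻¹E] = (-1)^m s⁻¹[D, E]` for `D ∈ Der^m(𝔥)`, `E ∈ Der^n(𝔥)`. -/
structure IsAction (𝔤 : SymGradedLie K 𝒢) (𝔥 : SymGradedLie K ℋ)
    (ρ : G →ₗ[K] Module.End K H) : Prop where
  map_mem : ∀ {i : ℤ} {x : G}, x ∈ 𝒢 i → ρ x ∈ der 𝔥 (i + 1)
  map_bracket : ∀ {i j : ℤ} {x y : G}, x ∈ 𝒢 i → y ∈ 𝒢 j →
    ρ (𝔤.bracket x y) =
      (-1 : K) ^ (i + 1) • gradedCommutator K H (i + 1) (j + 1) (ρ x) (ρ y)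

end Action

/-! ### Koszul signs and shuffles -/

/-- The Koszul sign `ε(σ; v₁, …, v_p)` for homogeneous `v_i` of degree `d i`, which is determined
by `v₁ ⊙ ⋯ ⊙ v_p = ε(σ) v_{σ(1)} ⊙ ⋯ ⊙ v_{σ(p)}`: a sign `(-1)^{d(a) d(b)}` for each pair `a, b`
whose order is reversed. -/
def koszulSign (K : Type*) [Field K] {p : ℕ} (σ : Equiv.Perm (Fin p)) (d : Fin p → ℤ) : K :=
  ∏ i : Fin p, ∏ j : Fin p,
    if i < j ∧ σ j < σ i then (-1 : K) ^ (d (σ i) * d (σ j)) else 1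

/-- The `(a, p - a)`-shuffles. -/
def shuffles (p a : ℕ) : Finset (Equiv.Perm (Fin p)) :=
  univ.filter fun σ => ∀ i j : Fin p, i < j → ((j : ℕ) < a ∨ a ≤ (i : ℕ)) → σ i < σ j

/-- The `(l, 1, p - l - 1)`-shuffles. -/
def shuffles₃ (p l : ℕ) : Finset (Equiv.Perm (Fin p)) :=
  univ.filter fun σ => ∀ i j : Fin p, i < j → ((j : ℕ) < l ∨ l < (i : ℕ)) → σ i < σ j

/-! ### Cochains -/

/-- `k`-linear maps `H × ⋯ × H → W`. -/
abbrev Multi (K H W : Type*) [Field K] [AddCommGroup H] [Module K H] [AddCommGroup W] [Module K W]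
    (k : ℕ) : Type _ :=
  MultilinearMap K (fun _ : Fin k => H) W

/-- Families `f = (f_k)_{k ≥ 0}` of multilinear maps. -/
abbrev Family (K H W : Type*) [Field K] [AddCommGroup H] [Module K H] [AddCommGroup W]
    [Module K W] : Type _ :=
  ∀ k : ℕ, Multi K H W k

section Cochains

variable {K G H W U : Type*} [Field K] [AddCommGroup G] [Module K G] [AddCommGroup H] [Module K H]
  [AddCommGroup W] [Module K W] [AddCommGroup U] [Module K U]
  {𝒢 : ℤ → Submodule K G}

/-- `Hom^n(S(H), W)`: the linear maps of degree `n` from the graded symmetric algebra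
`S(H) = ⨁ₖ S^k(H)` to `W`, that is, families `f = (f_k)` of multilinear maps of degree `n` which
are graded symmetric, `f_k(v₁, …, v_k) = ε(σ) f_k(v_{σ(1)}, …, v_{σ(k)})`. -/
def symHom (ℋ : ℤ → Submodule K H) (𝒲 : ℤ → Submodule K W) (n : ℤ) :
    Submodule K (Family K H W) where
  carrier := {f | ∀ (k : ℕ) (d : Fin k → ℤ) (v : Fin k → H), (∀ i, v i ∈ ℋ (d i)) →
    f k v ∈ 𝒲 (n + ∑ i, d i) ∧
      ∀ σ : Equiv.Perm (Fin k), f k v = koszulSign K σ d • f k (fun i => v (σ i))}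
  add_mem' := by
    intro f g hf hg k d v hv
    refine ⟨add_mem (hf k d v hv).1 (hg k d v hv).1, fun σ => ?_⟩
    simp only [Pi.add_apply, add_apply, smul_add]
    rw [← (hf k d v hv).2 σ, ← (hg k d v hv).2 σ]
  zero_mem' := by
    intro k d v _
    refine ⟨by simp, fun σ => by simp⟩
  smul_mem' := by
    intro c f hf k d v hv
    refine ⟨Submodule.smul_mem _ c (hf k d v hv).1, fun σ => ?_⟩
    simp only [Pi.smul_apply, smul_apply]
    rw [smul_comm, ← (hf k d v hv).2 σ]

/-- The multilinear map which is given by `φ d` on homogeneous arguments of degrees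
`d 0, …, d (p - 1)`. -/
noncomputable def ofHomogeneous (ℋ : ℤ → Submodule K H) [DirectSum.Decomposition ℋ] {p : ℕ}
    (φ : (Fin p → ℤ) → Multi K H W p) : Multi K H W p :=
  (MultilinearMap.fromDFinsuppEquiv (M := fun (_ : Fin p) (n : ℤ) => ℋ n) (fun _ : Fin p => ℤ) K
    fun d => (φ d).compLinearMap fun i => (ℋ (d i)).subtype).compLinearMap
      fun _ => (DirectSum.decomposeLinearEquiv ℋ).toLinearMap

/-- On homogeneous arguments, `ofHomogeneous ℋ φ` is what its name says. -/
theorem ofHomogeneous_apply (ℋ : ℤ → Submodule K H) [DirectSum.Decomposition ℋ] {p : ℕ}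
    (φ : (Fin p → ℤ) → Multi K H W p) (d : Fin p → ℤ) (v : Fin p → H) (hv : ∀ i, v i ∈ ℋ (d i)) :
    ofHomogeneous ℋ φ v = φ d v := by
  have h : (fun i => (DirectSum.decomposeLinearEquiv ℋ).toLinearMap (v i)) =
      fun i => DFinsupp.single (β := fun n => ℋ n) (d i) ⟨v i, hv i⟩ := by
    funext i
    exact DirectSum.decompose_of_mem ℋ (hv i)
  unfold ofHomogeneous
  rw [MultilinearMap.compLinearMap_apply, h, MultilinearMap.fromDFinsuppEquiv_single]
  simp

/-- The reindexing of `l + r` consecutive slots as `p = l + r` slots. -/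
def slots {p l r : ℕ} (h : l + r = p) : Fin l ⊕ Fin r ≃ Fin p :=
  finSumFinEquiv.trans (finCongr h)

/-- `(v₁, …, v_p) ↦ F(a(G(v_{σ(1)}, …, v_{σ(l)})) v_{σ(l+1)}, v_{σ(l+2)}, …, v_{σ(p)})`. -/
def insertTerm (a : U →ₗ[K] Module.End K H) {p l r : ℕ} (h : l + 1 + r = p)
    (F : Multi K H W (r + 1)) (G : Multi K H U l) (σ : Equiv.Perm (Fin p)) : Multi K H W p :=
  ((F.curryLeft.compMultilinearMap
    (MultilinearMap.uncurryRight (M := fun _ : Fin (l + 1) => H)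
      (a.compMultilinearMap G))).uncurrySum (N := fun _ => H)).domDomCongr
    ((slots h).trans σ)

theorem insertTerm_apply (a : U →ₗ[K] Module.End K H) {p l r : ℕ} (h : l + 1 + r = p)
    (F : Multi K H W (r + 1)) (G : Multi K H U l) (σ : Equiv.Perm (Fin p)) (v : Fin p → H) :
    insertTerm a h F G σ v =
      F (Fin.cons
        (a (G fun i : Fin l => v (σ ⟨i, by omega⟩)) (v (σ ⟨l, by omega⟩)))
        fun i : Fin r => v (σ ⟨l + 1 + i, by omega⟩)) :=
  rfl

/-- Composition `φ ↦ φ ∘ G`, as a linear map. -/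
def postcompose {r : ℕ} (G : Multi K H W r) : (W →ₗ[K] W) →ₗ[K] Multi K H W r where
  toFun φ := φ.compMultilinearMap G
  map_add' _ _ := rfl
  map_smul' _ _ := rfl

/-- `(v₁, …, v_p) ↦ b(F(v_{σ(1)}, …, v_{σ(l)}), G(v_{σ(l+1)}, …, v_{σ(p)}))`. -/
def pairTerm (b : W →ₗ[K] W →ₗ[K] W) {p l r : ℕ} (h : l + r = p)
    (F : Multi K H W l) (G : Multi K H W r) (σ : Equiv.Perm (Fin p)) : Multi K H W p :=
  (((postcompose G ∘ₗ b).compMultilinearMap F).uncurrySum (N := fun _ => H)).domDomCongr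
    ((slots h).trans σ)

theorem pairTerm_apply (b : W →ₗ[K] W →ₗ[K] W) {p l r : ℕ} (h : l + r = p)
    (F : Multi K H W l) (G : Multi K H W r) (σ : Equiv.Perm (Fin p)) (v : Fin p → H) :
    pairTerm b h F G σ v =
      b (F fun i : Fin l => v (σ ⟨i, by omega⟩)) (G fun i : Fin r => v (σ ⟨l + i, by omega⟩)) :=
  rfl

/-- `(v₁, …, v_{q+2}) ↦ F([v_i, v_j], v₁, …, v̂_i, …, v̂_j, …, v_{q+2})` for `i < j`; here `i` is
given as an element of `Fin (q + 1)`. -/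
def contractTerm {ℋ : ℤ → Submodule K H} (𝔥 : SymGradedLie K ℋ) {q : ℕ}
    (F : Multi K H W (q + 1)) (i : Fin (q + 1)) (j : Fin (q + 2)) (hij : i.castSucc < j) :
    Multi K H W (q + 2) where
  toFun v := F (Fin.cons (𝔥.bracket (v i.castSucc) (v j))
    fun t : Fin q => v (j.succAbove (i.succAbove t)))
  map_update_add' := by
    intro dec v t x y
    obtain rfl := Subsingleton.elim dec (instDecidableEqFin _)
    rw [← Fin.succAbove_of_castSucc_lt j i hij]
    change F.curryLeft _ _ = F.curryLeft _ _ + F.curryLeft _ _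
    cases t using Fin.succAboveCases j with
    | x => simp [Fin.succAbove_ne]
    | p t =>
      cases t using Fin.succAboveCases i with
      | x => simp [Fin.ne_succAbove, Fin.succAbove_ne]
      | p t =>
        have key : ∀ z : H, (fun t' => Function.update v (j.succAbove (i.succAbove t)) z
            (j.succAbove (i.succAbove t'))) =
              Function.update (fun t' => v (j.succAbove (i.succAbove t'))) t z := fun z =>
          Function.update_comp_eq_of_injective v
            (Fin.succAbove_right_injective.comp Fin.succAbove_right_injective) t z
        simp only [key]
        simp [Fin.ne_succAbove]
  map_update_smul' := by
    intro dec v t c x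
    obtain rfl := Subsingleton.elim dec (instDecidableEqFin _)
    rw [← Fin.succAbove_of_castSucc_lt j i hij]
    change F.curryLeft _ _ = c • F.curryLeft _ _
    cases t using Fin.succAboveCases j with
    | x => simp [Fin.succAbove_ne]
    | p t =>
      cases t using Fin.succAboveCases i with
      | x => simp [Fin.ne_succAbove, Fin.succAbove_ne]
      | p t =>
        have key : ∀ z : H, (fun t' => Function.update v (j.succAbove (i.succAbove t)) z
            (j.succAbove (i.succAbove t'))) =
              Function.update (fun t' => v (j.succAbove (i.succAbove t'))) t z := fun z =>
          Function.update_comp_eq_of_injective v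
            (Fin.succAbove_right_injective.comp Fin.succAbove_right_injective) t z
        simp only [key]
        simp [Fin.ne_succAbove]

variable {ℋ : ℤ → Submodule K H} [DirectSum.Decomposition ℋ]

/-- The part `∑_{k+l=p+1} ∑_{σ ∈ S_(l,1,p-l-1)} ε(σ) f_{k-1}(a(g_l(v_{σ(1)}, …, v_{σ(l)}))
v_{σ(l+1)}, v_{σ(l+2)}, …, v_{σ(p)})` of the brackets below, for homogeneous `v_i` of degree
`d i`; there are no shuffles for `l ≥ p`. -/
def insertSum (a : U →ₗ[K] Module.End K H) (f : Family K H W) (g : Family K H U) (p : ℕ)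
    (d : Fin p → ℤ) : Multi K H W p :=
  ∑ l : Fin p, ∑ σ ∈ shuffles₃ p l, koszulSign K σ d •
    insertTerm a (l := l) (r := p - 1 - l) (by omega) (f (p - 1 - l + 1)) (g l) σ

/-- The differential on `Hom^n(S(𝔥), W)`: `(d g)_p(v₁, …, v_p)` is the sum over `i < j` of
`(-1)^{n+1+v_i(v₁+⋯+v_{i-1})+v_j(v₁+⋯+v_{j-1})+v_i v_j}
g_{p-1}([v_i, v_j], v₁, …, v̂_i, …, v̂_j, …, v_p)`. -/
noncomputable def differential (𝔥 : SymGradedLie K ℋ) (n : ℤ) (g : Family K H W) : Family K H W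
  | 0 => 0
  | 1 => 0
  | q + 2 => ofHomogeneous ℋ fun d =>
      ∑ i : Fin (q + 1), ∑ j : Fin (q + 2), if hij : i.castSucc < j then
        (-1 : K) ^ (n + 1 + d i.castSucc * (∑ t ∈ Iio i.castSucc, d t) + d j * (∑ t ∈ Iio j, d t)
          + d i.castSucc * d j) • contractTerm 𝔥 (g (q + 1)) i j hij
      else 0

/-- The bracket `⟦f, g⟧ ∈ Hom^{m+n+1}(S(𝔥), 𝔤)` of `f ∈ Hom^m(S(𝔥), 𝔤)` and
`g ∈ Hom^n(S(𝔥), 𝔤)`. -/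
noncomputable def actionBracket (𝔤 : SymGradedLie K 𝒢) (ℋ : ℤ → Submodule K H)
    [DirectSum.Decomposition ℋ] (ρ : G →ₗ[K] Module.End K H) (m n : ℤ) (f g : Family K H G) : Family K H G := fun p =>
  ofHomogeneous ℋ fun d =>
    -insertSum ρ f g p d
    + (-1 : K) ^ ((m + 1) * (n + 1)) • insertSum ρ g f p d
    - ∑ l : Fin (p + 1), ∑ σ ∈ shuffles p l,
        ((-1 : K) ^ (n * (∑ i : Fin l, d (σ ⟨i, by omega⟩)) + m + 1) * koszulSign K σ d) •
          pairTerm 𝔤.bracket (l := l) (r := p - l) (by omega) (f l) (g (p - l)) σ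

/-- The bracket `[α, β]^c ∈ Hom^{m+n+1}(S(𝔥), s⁻¹Der(𝔥))` of `α ∈ Hom^m(S(𝔥), s⁻¹Der(𝔥))` and
`β ∈ Hom^n(S(𝔥), s⁻¹Der(𝔥))`.  In the last sum `s α_l(v_{σ(1)}, …, v_{σ(l)})` is a derivation of
degree `m + v_{σ(1)} + ⋯ + v_{σ(l)} + 1`, and similarly for `β`. -/
noncomputable def derBracket (ℋ : ℤ → Submodule K H) [DirectSum.Decomposition ℋ] (m n : ℤ)
    (α β : Family K H (Module.End K H)) : Family K H (Module.End K H) := fun p =>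
  ofHomogeneous ℋ fun d =>
    -insertSum LinearMap.id α β p d
    + (-1 : K) ^ ((m + 1) * (n + 1)) • insertSum LinearMap.id β α p d
    - ∑ l : Fin (p + 1), ∑ σ ∈ shuffles p l,
        ((-1 : K) ^ ((n + 1) * (∑ i : Fin l, d (σ ⟨i, by omega⟩))) * koszulSign K σ d) •
          pairTerm
            (gradedCommutator K H
              (m + (∑ i : Fin l, d (σ ⟨i, by omega⟩)) + 1)
              (n + (∑ i : Fin (p - l), d (σ ⟨l + i, by omega⟩)) + 1))
            (l := l) (r := p - l) (by omega) (α l) (β (p - l)) σ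

/-- `(sC^*(𝔥, 𝔤), ⟦·,·⟧, d)` with `C^n(𝔥, 𝔤) = Hom^n(S(𝔥), 𝔤)`, so that
`(sC^*)^n = C^{n-1}`. -/
noncomputable def actionDGLie (𝔤 : SymGradedLie K 𝒢) (𝔥 : SymGradedLie K ℋ)
    (ρ : G →ₗ[K] Module.End K H) : DGLieData K (Family K H G) where
  comp n := symHom ℋ 𝒢 (n - 1)
  bracket m n := actionBracket 𝔤 ℋ ρ (m - 1) (n - 1)
  diff n := differential 𝔥 (n - 1)

/-- `(sC̄^*(𝔥, 𝔥), [·,·]^c, ∂)` with `C̄^n(𝔥, 𝔥) = Hom^n(S(𝔥), s⁻¹Der(𝔥))`, so that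
`(sC̄^*)^n = C̄^{n-1}`. -/
noncomputable def derDGLie (𝔥 : SymGradedLie K ℋ) :
    DGLieData K (Family K H (Module.End K H)) where
  comp n := symHom ℋ (desuspDer 𝔥) (n - 1)
  bracket m n := derBracket ℋ (m - 1) (n - 1)
  diff n := differential 𝔥 (n - 1)

/-- `Ψ(f) = s⁻¹ ∘ ρ ∘ f`, that is, `Ψ(f)_k = s⁻¹ ∘ ρ ∘ f_k`. -/
def Psi (ρ : G →ₗ[K] Module.End K H) : Family K H G →ₗ[K] Family K H (Module.End K H) where
  toFun f k := ρ.compMultilinearMap (f k)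
  map_add' f g := by funext k; ext v; simp
  map_smul' c f := by funext k; ext v; simp

end Cochains

end HomotopyLie

/-! View a cochain as a formal function f(x) on 𝔥, and let `fixFirst a` be its derivative in the
direction a. The action turns f into a vector field X_f(x) = ρ(f(x))x (`vectorField`), and the
bracket of 𝔥 into the quadratic vector field q(x) = ½[x,x] (`bracketCochain`). Writing X·f for the
derivative of f along X (`ins`) and [f,g] for the pointwise bracket (`prod`), the data of the
theorem become, up to signs, ⟦f,g⟧ = -X_g·f + X_f·g - [f,g] and df = q·f.

Everything then follows from a few facts. Insertion is a derivation of products (`ins_prod`) and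
satisfies the graded pre-Lie identity (`ins_ins`); pointwise products inherit symmetry and the
Jacobi identity from the coefficients (`prod_comm`, `prod_leibniz`). Since ρ respects brackets, X of
⟦f,g⟧ is the commutator of the vector fields (`vectorField_cochainBracket`), which gives the Jacobi
identity. The Jacobi identity of 𝔥 at (x,x,x) gives q·q = 0 (`ins_bracketCochain_self`), hence d² =
0. Since ρ takes values in derivations, q commutes with X_g up to the field of q·g
(`ins_bracketCochain_vectorField`), so d is a derivation of the bracket.

Both algebras are instances of one construction: coefficients in a graded Lie structure acting on 𝔥,
where s⁻¹Der(𝔥) acts tautologically. The bracket of the coefficients may depend on degrees, because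
that of s⁻¹Der(𝔥) does. As ρ intertwines the two actions, f and Ψ(f) have the same vector field, and
Ψ is a homomorphism (`comp_cochainBracket`).

Signs and shuffles are controlled by recursion on lists of homogeneous arguments. `prod` and `ins`
are defined by their Leibniz rules under `fixFirst`, so that an identity needs only its value on the
empty list and a parity check for one more argument. The shuffle formulas obey the same recursions:
the first argument must come first in its block (`insPerm_mem_shuffles`), whence `sum_shuffles`,
`sum_shuffles₃` and `sum_pickTwo`. -/

namespace HomotopyLie

open Finset

set_option linter.unusedSectionVars false
set_option linter.unusedSimpArgs false

/-! ### Cochains as functions of lists of homogeneous elements -/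

section ListCochains

/-- The parity of an integer: `true` for odd integers. -/
def odd (n : ℤ) : Bool := decide (Odd n)

@[simp] theorem odd_add (m n : ℤ) : odd (m + n) = xor (odd m) (odd n) := by
  by_cases hm : Even m <;> by_cases hn : Even n <;>
    simp [odd, ← Int.not_even_iff_odd, Int.even_add, hm, hn]

@[simp] theorem odd_mul (m n : ℤ) : odd (m * n) = (odd m && odd n) := by
  simp [odd, Int.odd_mul]

@[simp] theorem odd_one : odd 1 = true := by simp [odd]

@[simp] theorem odd_zero : odd 0 = false := by simp [odd]

/-- Signs depend only on parities, so after this rewriting a sign identity is a finite case check on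
Booleans. -/
theorem negOne_zpow (K : Type*) [Field K] (n : ℤ) :
    (-1 : K) ^ n = bif odd n then -1 else 1 := by
  by_cases h : Even n
  · simp [odd, ← Int.not_even_iff_odd, h, h.neg_one_zpow]
  · rw [(Int.not_even_iff_odd.1 h).neg_one_zpow]
    simp [odd, ← Int.not_even_iff_odd, h]

variable {K G H W U Z Y₁ Y₂ Y₃ : Type*} [Field K] [AddCommGroup G] [Module K G] [AddCommGroup H]
  [Module K H] [AddCommGroup W] [Module K W] [AddCommGroup U] [Module K U]
  [AddCommGroup Z] [Module K Z] [AddCommGroup Y₁] [Module K Y₁] [AddCommGroup Y₂] [Module K Y₂]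
  [AddCommGroup Y₃] [Module K Y₃]
  {ℋ : ℤ → Submodule K H} {𝒲 : ℤ → Submodule K W} {𝒰 : ℤ → Submodule K U}
  {𝒵 : ℤ → Submodule K Z}

/-- Homogeneous elements of `H`, bundled with their degree. -/
abbrev Homog (ℋ : ℤ → Submodule K H) : Type _ := Σ i, ℋ i

/-- The total degree of a list of homogeneous elements. -/
def deg (l : List (Homog ℋ)) : ℤ := (l.map Sigma.fst).sum

@[simp] theorem deg_nil : deg ([] : List (Homog ℋ)) = 0 := rfl

@[simp] theorem deg_cons (a : Homog ℋ) (l : List (Homog ℋ)) : deg (a :: l) = a.1 + deg l := by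
  simp [deg]

@[simp] theorem deg_append (l l' : List (Homog ℋ)) : deg (l ++ l') = deg l + deg l' := by
  simp [deg]

/-- The homogeneous component of degree `n`, as a homogeneous element. -/
def homogPart (ℋ : ℤ → Submodule K H) [DirectSum.Decomposition ℋ] (n : ℤ) (v : H) : Homog ℋ :=
  ⟨n, DirectSum.decompose ℋ v n⟩

section
variable [DirectSum.Decomposition ℋ]

@[simp] theorem homogPart_fst (n : ℤ) (v : H) : (homogPart ℋ n v).1 = n := rfl

theorem homogPart_of_mem {n : ℤ} {v : H} (hv : v ∈ ℋ n) : homogPart ℋ n v = ⟨n, v, hv⟩ := by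
  have : DirectSum.decompose ℋ v n = ⟨v, hv⟩ := by
    ext; exact DirectSum.decompose_of_mem_same ℋ hv
  rw [homogPart, this]

end

/-- The derivative of a function of lists: insert `a` in front of the arguments. -/
def fixFirst (a : Homog ℋ) (f : List (Homog ℋ) → W) : List (Homog ℋ) → W := fun l => f (a :: l)

@[simp] theorem fixFirst_add (a : Homog ℋ) (f g : List (Homog ℋ) → W) :
    fixFirst a (f + g) = fixFirst a f + fixFirst a g := rfl

@[simp] theorem fixFirst_smul (a : Homog ℋ) (c : K) (f : List (Homog ℋ) → W) :
    fixFirst a (c • f) = c • fixFirst a f := rfl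

@[simp] theorem fixFirst_zero (a : Homog ℋ) :
    fixFirst a (0 : List (Homog ℋ) → W) = 0 := rfl

/-- `f` has degree `m`. -/
def HasDeg (𝒲 : ℤ → Submodule K W) (m : ℤ) (f : List (Homog ℋ) → W) : Prop :=
  ∀ l, f l ∈ 𝒲 (m + deg l)

theorem HasDeg.fixFirst {m : ℤ} {f : List (Homog ℋ) → W} (hf : HasDeg 𝒲 m f) (a : Homog ℋ) :
    HasDeg 𝒲 (m + a.1) (fixFirst a f) := by
  intro l
  have := hf (a :: l)
  rwa [deg_cons, ← add_assoc] at this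

theorem HasDeg.nil_mem {m : ℤ} {f : List (Homog ℋ) → W} (hf : HasDeg 𝒲 m f) : f [] ∈ 𝒲 m := by
  simpa using hf []

theorem HasDeg.smul {m : ℤ} {f : List (Homog ℋ) → W} (c : K) (hf : HasDeg 𝒲 m f) :
    HasDeg 𝒲 m (c • f) := fun l => Submodule.smul_mem _ c (hf l)

/-- `f` is multilinear and graded symmetric. -/
structure IsSymMultilinear (f : List (Homog ℋ) → W) : Prop where
  add : ∀ (l l' : List (Homog ℋ)) (i : ℤ) (x y : ℋ i),
    f (l ++ ⟨i, x + y⟩ :: l') = f (l ++ ⟨i, x⟩ :: l') + f (l ++ ⟨i, y⟩ :: l')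
  smul : ∀ (l l' : List (Homog ℋ)) (i : ℤ) (c : K) (x : ℋ i),
    f (l ++ ⟨i, c • x⟩ :: l') = c • f (l ++ ⟨i, x⟩ :: l')
  swap : ∀ (l l' : List (Homog ℋ)) (a b : Homog ℋ),
    f (l ++ a :: b :: l') = (-1 : K) ^ (a.1 * b.1) • f (l ++ b :: a :: l')

namespace IsSymMultilinear

variable {f g : List (Homog ℋ) → W}

theorem fixFirst (hf : IsSymMultilinear f) (a : Homog ℋ) : IsSymMultilinear (fixFirst a f) where
  add l := hf.add (a :: l)
  smul l := hf.smul (a :: l)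
  swap l := hf.swap (a :: l)

theorem sum (hf : IsSymMultilinear f) (hg : IsSymMultilinear g) : IsSymMultilinear (f + g) where
  add l l' i x y := by simp only [Pi.add_apply, hf.add, hg.add]; abel
  smul l l' i c x := by simp only [Pi.add_apply, hf.smul, hg.smul, smul_add]
  swap l l' a b := by rw [Pi.add_apply, hf.swap, hg.swap, Pi.add_apply, smul_add]

theorem const_smul (c : K) (hf : IsSymMultilinear f) : IsSymMultilinear (c • f) where
  add l l' i x y := by simp only [Pi.smul_apply, hf.add, smul_add]
  smul l l' i d x := by simp only [Pi.smul_apply, hf.smul, smul_comm d c]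
  swap l l' a b := by rw [Pi.smul_apply, hf.swap, Pi.smul_apply, smul_comm]

theorem fixFirst_add (hf : IsSymMultilinear f) {i : ℤ} (x y : ℋ i) :
    HomotopyLie.fixFirst ⟨i, x + y⟩ f =
      HomotopyLie.fixFirst ⟨i, x⟩ f + HomotopyLie.fixFirst ⟨i, y⟩ f :=
  funext fun l => hf.add [] l i x y

theorem fixFirst_smul (hf : IsSymMultilinear f) {i : ℤ} (c : K) (x : ℋ i) :
    HomotopyLie.fixFirst ⟨i, c • x⟩ f = c • HomotopyLie.fixFirst ⟨i, x⟩ f :=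
  funext fun l => hf.smul [] l i c x

theorem fixFirst_comm (hf : IsSymMultilinear f) (a b : Homog ℋ) :
    HomotopyLie.fixFirst b (HomotopyLie.fixFirst a f) =
      (-1 : K) ^ (a.1 * b.1) • HomotopyLie.fixFirst a (HomotopyLie.fixFirst b f) :=
  funext fun l => hf.swap [] l a b

theorem apply_homogPart_add [DirectSum.Decomposition ℋ] (hf : IsSymMultilinear f) (n : ℤ)
    (v w : H) (l : List (Homog ℋ)) :
    f (homogPart ℋ n (v + w) :: l) = f (homogPart ℋ n v :: l) + f (homogPart ℋ n w :: l) := by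
  simp only [homogPart, DirectSum.decompose_add, DirectSum.add_apply]
  exact hf.add [] l n _ _

theorem apply_homogPart_smul [DirectSum.Decomposition ℋ] (hf : IsSymMultilinear f) (n : ℤ)
    (c : K) (v : H) (l : List (Homog ℋ)) :
    f (homogPart ℋ n (c • v) :: l) = c • f (homogPart ℋ n v :: l) := by
  simp only [homogPart, DirectSum.decompose_smul]
  exact hf.smul [] l n c _

end IsSymMultilinear

/-! ### Products of cochains -/

/-- The product of cochains `f`, `g` of degrees `m`, `n` with respect to a family of bilinear maps
which depends on the degrees of the arguments: the sum over all unshuffles of the arguments. -/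
def prod (b : ℤ → ℤ → W →ₗ[K] U →ₗ[K] Z) :
    ℤ → ℤ → (List (Homog ℋ) → W) → (List (Homog ℋ) → U) → List (Homog ℋ) → Z
  | m, n, f, g, [] => b m n (f []) (g [])
  | m, n, f, g, a :: l => (-1 : K) ^ (n * a.1) • prod b (m + a.1) n (fixFirst a f) g l +
      prod b m (n + a.1) f (fixFirst a g) l

section prod

variable (b : ℤ → ℤ → W →ₗ[K] U →ₗ[K] Z)

theorem fixFirst_prod (m n : ℤ) (f : List (Homog ℋ) → W) (g : List (Homog ℋ) → U) (a : Homog ℋ) :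
    fixFirst a (prod b m n f g) = (-1 : K) ^ (n * a.1) • prod b (m + a.1) n (fixFirst a f) g +
      prod b m (n + a.1) f (fixFirst a g) := rfl

theorem prod_add_left (m n : ℤ) (f f' : List (Homog ℋ) → W) (g : List (Homog ℋ) → U) :
    prod b m n (f + f') g = prod b m n f g + prod b m n f' g := by
  funext l
  induction l generalizing m n f f' g with
  | nil => simp [prod]
  | cons a l ih => simp only [prod, fixFirst_add, ih, Pi.add_apply, smul_add]; abel

theorem prod_smul_left (m n : ℤ) (c : K) (f : List (Homog ℋ) → W) (g : List (Homog ℋ) → U) :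
    prod b m n (c • f) g = c • prod b m n f g := by
  funext l
  induction l generalizing m n f g with
  | nil => simp [prod]
  | cons a l ih =>
    simp only [prod, fixFirst_smul, ih, Pi.smul_apply, smul_add]
    rw [smul_comm]

theorem prod_add_right (m n : ℤ) (f : List (Homog ℋ) → W) (g g' : List (Homog ℋ) → U) :
    prod b m n f (g + g') = prod b m n f g + prod b m n f g' := by
  funext l
  induction l generalizing m n f g g' with
  | nil => simp [prod]
  | cons a l ih => simp only [prod, fixFirst_add, ih, Pi.add_apply, smul_add]; abel

theorem prod_smul_right (m n : ℤ) (c : K) (f : List (Homog ℋ) → W) (g : List (Homog ℋ) → U) :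
    prod b m n f (c • g) = c • prod b m n f g := by
  funext l
  induction l generalizing m n f g with
  | nil => simp [prod]
  | cons a l ih =>
    simp only [prod, fixFirst_smul, ih, Pi.smul_apply, smul_add]
    rw [smul_comm]

theorem prod_zero_left (m n : ℤ) (g : List (Homog ℋ) → U) : prod b m n 0 g = 0 := by
  simpa using prod_smul_left b m n (0 : K) 0 g

theorem prod_zero_right (m n : ℤ) (f : List (Homog ℋ) → W) : prod b m n f 0 = 0 := by
  simpa using prod_smul_right b m n (0 : K) f 0

theorem HasDeg.prod {δ : ℤ} (hb : ∀ {i j x y}, x ∈ 𝒲 i → y ∈ 𝒰 j → b i j x y ∈ 𝒵 (i + j + δ))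
    {m n : ℤ} {f : List (Homog ℋ) → W} {g : List (Homog ℋ) → U} (hf : HasDeg 𝒲 m f)
    (hg : HasDeg 𝒰 n g) : HasDeg 𝒵 (m + n + δ) (prod b m n f g) := by
  intro l
  induction l generalizing m n f g with
  | nil => simpa [HomotopyLie.prod] using hb hf.nil_mem hg.nil_mem
  | cons a l ih =>
    refine add_mem (Submodule.smul_mem _ _ ?_) ?_
    · convert ih (hf.fixFirst a) hg using 2
      rw [deg_cons]; ring
    · convert ih hf (hg.fixFirst a) using 2
      rw [deg_cons]; ring

theorem IsSymMultilinear.prod {m n : ℤ} {f : List (Homog ℋ) → W} {g : List (Homog ℋ) → U}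
    (hf : IsSymMultilinear f) (hg : IsSymMultilinear g) : IsSymMultilinear (prod b m n f g) := by
  -- Induction on the number N of arguments in front of the affected slot. The cochains and degrees
  -- must vary, because removing the head argument replaces one factor by its derivative.
  suffices ∀ N : ℕ, ∀ {m n : ℤ} {f : List (Homog ℋ) → W} {g : List (Homog ℋ) → U}
    (hf : IsSymMultilinear f) (hg : IsSymMultilinear g),
    (∀ (l l' : List (Homog ℋ)) (i : ℤ) (x y : ℋ i), l.length = N →
      HomotopyLie.prod b m n f g (l ++ ⟨i, x + y⟩ :: l') =
        HomotopyLie.prod b m n f g (l ++ ⟨i, x⟩ :: l') +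
          HomotopyLie.prod b m n f g (l ++ ⟨i, y⟩ :: l')) ∧
    (∀ (l l' : List (Homog ℋ)) (i : ℤ) (c : K) (x : ℋ i), l.length = N →
      HomotopyLie.prod b m n f g (l ++ ⟨i, c • x⟩ :: l') =
        c • HomotopyLie.prod b m n f g (l ++ ⟨i, x⟩ :: l')) ∧
    (∀ (l l' : List (Homog ℋ)) (p q : Homog ℋ), l.length = N →
      HomotopyLie.prod b m n f g (l ++ p :: q :: l') =
        (-1 : K) ^ (p.1 * q.1) • HomotopyLie.prod b m n f g (l ++ q :: p :: l')) from
    ⟨fun l l' i x y => (this _ hf hg).1 l l' i x y rfl,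
      fun l l' i x y => (this _ hf hg).2.1 l l' i x y rfl,
      fun l l' p q => (this _ hf hg).2.2 l l' p q rfl⟩
  intro N
  induction N with
  | zero =>
    intro m n f g hf hg
    refine ⟨fun l l' i x y hl => ?_, fun l l' i c x hl => ?_, fun l l' p q hl => ?_⟩ <;>
      obtain rfl := List.length_eq_zero_iff.1 hl
    · simp only [List.nil_append, HomotopyLie.prod, hf.fixFirst_add, hg.fixFirst_add,
        prod_add_left, prod_add_right, Pi.add_apply, smul_add]
      abel
    · simp only [List.nil_append, HomotopyLie.prod, hf.fixFirst_smul, hg.fixFirst_smul,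
        prod_smul_left, prod_smul_right, Pi.smul_apply, smul_add]
      rw [smul_comm]
    · simp only [List.nil_append, HomotopyLie.prod]
      rw [hf.fixFirst_comm p q, hg.fixFirst_comm p q, prod_smul_left, prod_smul_right,
        add_right_comm m p.1, add_right_comm n p.1]
      simp only [Pi.smul_apply, negOne_zpow]
      cases hp : odd p.1 <;> cases hq : odd q.1 <;> cases hn : odd n <;>
        simp [hp, hq, hn] <;> abel
  | succ N ih =>
    intro m n f g hf hg
    refine ⟨fun l l' i x y hl => ?_, fun l l' i c x hl => ?_, fun l l' p q hl => ?_⟩ <;>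
    · obtain ⟨a, l, rfl⟩ := List.exists_cons_of_length_eq_add_one hl
      have hl : l.length = N := by simpa using hl
      have h1 := @ih (m + a.1) n _ _ (hf.fixFirst a) hg
      have h2 := @ih m (n + a.1) _ _ hf (hg.fixFirst a)
      simp only [List.cons_append, HomotopyLie.prod]
      first
      | rw [h1.1 _ _ _ _ _ hl, h2.1 _ _ _ _ _ hl]; module
      | rw [h1.2.1 _ _ _ _ _ hl, h2.2.1 _ _ _ _ _ hl]; module
      | rw [h1.2.2 _ _ _ _ hl, h2.2.2 _ _ _ _ hl]; module

/-- The two summands of the recursion are exchanged. The degree hypotheses guarantee that the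
symmetry of the bilinear maps applies once the list is exhausted. -/
theorem prod_comm (b' : ℤ → ℤ → U →ₗ[K] W →ₗ[K] Z)
    (hb : ∀ {i j x y}, x ∈ 𝒲 i → y ∈ 𝒰 j → b i j x y = (-1 : K) ^ (i * j) • b' j i y x)
    {m n : ℤ} {f : List (Homog ℋ) → W} {g : List (Homog ℋ) → U} (hf : HasDeg 𝒲 m f)
    (hg : HasDeg 𝒰 n g) : prod b m n f g = (-1 : K) ^ (m * n) • prod b' n m g f := by
  funext l
  induction l generalizing m n f g with
  | nil => exact hb hf.nil_mem hg.nil_mem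
  | cons a l ih =>
    simp only [prod, Pi.smul_apply] at ih ⊢
    rw [ih (hf.fixFirst a) hg, ih hf (hg.fixFirst a)]
    simp only [negOne_zpow]
    cases ha : odd a.1 <;> cases hm : odd m <;> cases hn : odd n <;>
      simp [ha, hm, hn] <;> abel

/-- The Leibniz (Jacobi) identity passes from bilinear maps to products of cochains. -/
theorem prod_leibniz {b₁ : ℤ → ℤ → W →ₗ[K] Y₁ →ₗ[K] Y₃} {b₂ : ℤ → ℤ → U →ₗ[K] Z →ₗ[K] Y₁}
    {b₃ : ℤ → ℤ → Y₂ →ₗ[K] Z →ₗ[K] Y₃} {b₄ : ℤ → ℤ → W →ₗ[K] U →ₗ[K] Y₂}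
    {G : Type*} [AddCommGroup G] [Module K G]
    {b₅ : ℤ → ℤ → U →ₗ[K] G →ₗ[K] Y₃} {b₆ : ℤ → ℤ → W →ₗ[K] Z →ₗ[K] G}
    (hb : ∀ {i j k x y z}, x ∈ 𝒲 i → y ∈ 𝒰 j → z ∈ 𝒵 k →
      b₁ i (j + k + 1) x (b₂ j k y z) = (-1 : K) ^ (i + 1) • b₃ (i + j + 1) k (b₄ i j x y) z +
        (-1 : K) ^ ((i + 1) * (j + 1)) • b₅ j (i + k + 1) y (b₆ i k x z))
    {m n k : ℤ} {f : List (Homog ℋ) → W} {g : List (Homog ℋ) → U} {h : List (Homog ℋ) → Z}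
    (hf : HasDeg 𝒲 m f) (hg : HasDeg 𝒰 n g) (hh : HasDeg 𝒵 k h) :
    prod b₁ m (n + k + 1) f (prod b₂ n k g h) =
      (-1 : K) ^ (m + 1) • prod b₃ (m + n + 1) k (prod b₄ m n f g) h +
        (-1 : K) ^ ((m + 1) * (n + 1)) • prod b₅ n (m + k + 1) g (prod b₆ m k f h) := by
  funext l
  induction l generalizing m n k f g h with
  | nil => exact hb hf.nil_mem hg.nil_mem hh.nil_mem
  | cons a l ih =>
    -- One induction hypothesis for each of the three factors that can absorb `a`; the degree
    -- indices are then normalised so that equal products match syntactically.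
    have h1 := ih (hf.fixFirst a) hg hh
    have h2 := ih hf (hg.fixFirst a) hh
    have h3 := ih hf hg (hh.fixFirst a)
    rw [show n + a.1 + k + 1 = n + k + 1 + a.1 by ring,
      show m + (n + a.1) + 1 = m + n + 1 + a.1 by ring] at h2
    rw [show m + a.1 + n + 1 = m + n + 1 + a.1 by ring,
      show m + a.1 + k + 1 = m + k + 1 + a.1 by ring] at h1
    rw [show n + (k + a.1) + 1 = n + k + 1 + a.1 by ring,
      show m + (k + a.1) + 1 = m + k + 1 + a.1 by ring] at h3
    simp only [prod, fixFirst_prod, prod_add_left, prod_add_right, prod_smul_left,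
      prod_smul_right, Pi.add_apply, Pi.smul_apply] at h1 h2 h3 ⊢
    rw [h1, h2, h3]
    simp only [negOne_zpow]
    cases ha : odd a.1 <;> cases hm : odd m <;> cases hn : odd n <;>
      cases hk : odd k <;> simp [ha, hm, hn, hk] <;> abel

/-- Homomorphisms are compatible with products of cochains. -/
theorem comp_prod {W' U' Z' : Type*} [AddCommGroup W'] [Module K W'] [AddCommGroup U']
    [Module K U'] [AddCommGroup Z'] [Module K Z'] (b' : ℤ → ℤ → W' →ₗ[K] U' →ₗ[K] Z')
    (φ : W →ₗ[K] W') (ψ : U →ₗ[K] U') (χ : Z →ₗ[K] Z')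
    (hb : ∀ {i j x y}, x ∈ 𝒲 i → y ∈ 𝒰 j → χ (b i j x y) = b' i j (φ x) (ψ y))
    {m n : ℤ} {f : List (Homog ℋ) → W} {g : List (Homog ℋ) → U} (hf : HasDeg 𝒲 m f)
    (hg : HasDeg 𝒰 n g) : χ ∘ prod b m n f g = prod b' m n (φ ∘ f) (ψ ∘ g) := by
  funext l
  induction l generalizing m n f g with
  | nil => exact hb hf.nil_mem hg.nil_mem
  | cons a l ih =>
    have h1 := ih (hf.fixFirst a) hg
    have h2 := ih hf (hg.fixFirst a)
    simp only [Function.comp_apply, prod, map_add, map_smul] at h1 h2 ⊢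
    rw [h1, h2]
    rfl

end prod

end ListCochains

section Insertion

variable {K G H W U Z : Type*} [Field K] [AddCommGroup G] [Module K G] [AddCommGroup H]
  [Module K H] [AddCommGroup W] [Module K W] [AddCommGroup U] [Module K U]
  [AddCommGroup Z] [Module K Z]
  {ℋ : ℤ → Submodule K H} {𝒲 : ℤ → Submodule K W}

/-! ### The identity cochain -/

/-- The projection `S(H) → S¹(H) = H`. -/
def idCochain (ℋ : ℤ → Submodule K H) : List (Homog ℋ) → H
  | [a] => a.2
  | _ => 0

theorem hasDeg_idCochain : HasDeg ℋ 0 (idCochain ℋ)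
  | [] => zero_mem _
  | [a] => by simp [idCochain]
  | _ :: _ :: _ => zero_mem _

theorem isSymMultilinear_idCochain : IsSymMultilinear (idCochain ℋ) where
  add l l' i x y := by
    match l, l' with
    | [], [] => simp [idCochain]
    | [], _ :: _ => simp [idCochain]
    | [_], _ => simp [idCochain]
    | _ :: _ :: _, _ => simp [idCochain]
  smul l l' i c x := by
    match l, l' with
    | [], [] => simp [idCochain]
    | [], _ :: _ => simp [idCochain]
    | [_], _ => simp [idCochain]
    | _ :: _ :: _, _ => simp [idCochain]
  swap l l' a b := by
    match l with
    | [] => simp [idCochain]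
    | [_] => simp [idCochain]
    | _ :: _ :: _ => simp [idCochain]

theorem fixFirst_fixFirst_idCochain (a b : Homog ℋ) :
    fixFirst b (fixFirst a (idCochain ℋ)) = 0 := rfl

variable [DirectSum.Decomposition ℋ]

/-! ### Insertion of cochains -/

/-- The insertion of an `H`-valued cochain `r` of degree `n` into the first slot of a cochain `f`,
summed over all unshuffles of the arguments. -/
def ins : ℤ → (List (Homog ℋ) → H) → (List (Homog ℋ) → W) → List (Homog ℋ) → W
  | n, r, f, [] => f [homogPart ℋ n (r [])]
  | n, r, f, a :: l => ins (n + a.1) (fixFirst a r) f l +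
      (-1 : K) ^ (n * a.1) • ins n r (fixFirst a f) l

theorem fixFirst_ins (n : ℤ) (r : List (Homog ℋ) → H) (f : List (Homog ℋ) → W) (a : Homog ℋ) :
    fixFirst a (ins n r f) = ins (n + a.1) (fixFirst a r) f +
      (-1 : K) ^ (n * a.1) • ins n r (fixFirst a f) := rfl

theorem ins_add_right (n : ℤ) (r : List (Homog ℋ) → H) (f f' : List (Homog ℋ) → W) :
    ins n r (f + f') = ins n r f + ins n r f' := by
  funext l
  induction l generalizing n r f f' with
  | nil => simp [ins]
  | cons a l ih => simp only [ins, fixFirst_add, ih, Pi.add_apply, smul_add]; abel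

theorem ins_smul_right (n : ℤ) (c : K) (r : List (Homog ℋ) → H) (f : List (Homog ℋ) → W) :
    ins n r (c • f) = c • ins n r f := by
  funext l
  induction l generalizing n r f with
  | nil => simp [ins]
  | cons a l ih =>
    simp only [ins, fixFirst_smul, ih, Pi.smul_apply, smul_add]
    rw [smul_comm]

theorem ins_zero_right (n : ℤ) (r : List (Homog ℋ) → H) :
    ins n r (0 : List (Homog ℋ) → W) = 0 := by
  simpa using ins_smul_right n (0 : K) r (0 : List (Homog ℋ) → W)

/-- Unlike additivity in `f`, this needs `f` to be multilinear, since the value of `r` becomes an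
argument of `f`. -/
theorem IsSymMultilinear.ins_add_left {f : List (Homog ℋ) → W} (hf : IsSymMultilinear f) (n : ℤ)
    (r r' : List (Homog ℋ) → H) : ins n (r + r') f = ins n r f + ins n r' f := by
  funext l
  induction l generalizing n r r' f with
  | nil => simp only [ins, Pi.add_apply, hf.apply_homogPart_add]
  | cons a l ih =>
    simp only [ins, HomotopyLie.fixFirst_add, ih hf, ih (hf.fixFirst a), Pi.add_apply, smul_add]
    abel

theorem IsSymMultilinear.ins_smul_left {f : List (Homog ℋ) → W} (hf : IsSymMultilinear f) (n : ℤ)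
    (c : K) (r : List (Homog ℋ) → H) : ins n (c • r) f = c • ins n r f := by
  funext l
  induction l generalizing n r f with
  | nil => simp only [ins, Pi.smul_apply, hf.apply_homogPart_smul]
  | cons a l ih =>
    simp only [ins, HomotopyLie.fixFirst_smul, ih hf, ih (hf.fixFirst a), Pi.smul_apply, smul_add]
    rw [smul_comm c]

theorem IsSymMultilinear.ins_zero_left {f : List (Homog ℋ) → W} (hf : IsSymMultilinear f)
    (n : ℤ) : ins n 0 f = 0 := by
  simpa using hf.ins_smul_left n (0 : K) 0

/-- No condition on `r` is needed: `homogPart` projects its value to the expected degree. -/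
theorem HasDeg.ins {m : ℤ} {f : List (Homog ℋ) → W} (hf : HasDeg 𝒲 m f) (n : ℤ)
    (r : List (Homog ℋ) → H) : HasDeg 𝒲 (m + n) (ins n r f) := by
  intro l
  induction l generalizing m n r f with
  | nil => simpa [HomotopyLie.ins] using hf [homogPart ℋ n (r [])]
  | cons a l ih =>
    refine add_mem ?_ (Submodule.smul_mem _ _ ?_)
    · convert ih hf (n + a.1) (HomotopyLie.fixFirst a r) using 2
      rw [deg_cons]; ring
    · convert ih (hf.fixFirst a) n r using 2
      rw [deg_cons]; ring

theorem IsSymMultilinear.ins {r : List (Homog ℋ) → H} {f : List (Homog ℋ) → W}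
    (hr : IsSymMultilinear r) (hf : IsSymMultilinear f) (n : ℤ) :
    IsSymMultilinear (ins n r f) := by
  suffices ∀ N : ℕ, ∀ {n : ℤ} {r : List (Homog ℋ) → H} {f : List (Homog ℋ) → W}
    (hr : IsSymMultilinear r) (hf : IsSymMultilinear f),
    (∀ (l l' : List (Homog ℋ)) (i : ℤ) (x y : ℋ i), l.length = N →
      HomotopyLie.ins n r f (l ++ ⟨i, x + y⟩ :: l') =
        HomotopyLie.ins n r f (l ++ ⟨i, x⟩ :: l') +
          HomotopyLie.ins n r f (l ++ ⟨i, y⟩ :: l')) ∧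
    (∀ (l l' : List (Homog ℋ)) (i : ℤ) (c : K) (x : ℋ i), l.length = N →
      HomotopyLie.ins n r f (l ++ ⟨i, c • x⟩ :: l') =
        c • HomotopyLie.ins n r f (l ++ ⟨i, x⟩ :: l')) ∧
    (∀ (l l' : List (Homog ℋ)) (p q : Homog ℋ), l.length = N →
      HomotopyLie.ins n r f (l ++ p :: q :: l') =
        (-1 : K) ^ (p.1 * q.1) • HomotopyLie.ins n r f (l ++ q :: p :: l')) from
    ⟨fun l l' i x y => (this _ hr hf).1 l l' i x y rfl,
      fun l l' i x y => (this _ hr hf).2.1 l l' i x y rfl,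
      fun l l' p q => (this _ hr hf).2.2 l l' p q rfl⟩
  intro N
  induction N with
  | zero =>
    intro n r f hr hf
    refine ⟨fun l l' i x y hl => ?_, fun l l' i c x hl => ?_, fun l l' p q hl => ?_⟩ <;>
      obtain rfl := List.length_eq_zero_iff.1 hl
    · simp only [List.nil_append, HomotopyLie.ins, hr.fixFirst_add, hf.fixFirst_add,
        hf.ins_add_left, ins_add_right, Pi.add_apply, smul_add]
      abel
    · simp only [List.nil_append, HomotopyLie.ins, hr.fixFirst_smul, hf.fixFirst_smul,
        hf.ins_smul_left, ins_smul_right, Pi.smul_apply, smul_add]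
      rw [smul_comm c]
    · simp only [List.nil_append, HomotopyLie.ins]
      rw [hr.fixFirst_comm p q, hf.fixFirst_comm p q, hf.ins_smul_left, ins_smul_right,
        add_right_comm n p.1]
      simp only [Pi.smul_apply, negOne_zpow]
      cases hp : odd p.1 <;> cases hq : odd q.1 <;> cases hn : odd n <;>
        simp [hp, hq, hn] <;> abel
  | succ N ih =>
    intro n r f hr hf
    refine ⟨fun l l' i x y hl => ?_, fun l l' i c x hl => ?_, fun l l' p q hl => ?_⟩ <;>
    · obtain ⟨a, l, rfl⟩ := List.exists_cons_of_length_eq_add_one hl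
      have hl : l.length = N := by simpa using hl
      have h1 := @ih (n + a.1) _ _ (hr.fixFirst a) hf
      have h2 := @ih n _ _ hr (hf.fixFirst a)
      simp only [List.cons_append, HomotopyLie.ins]
      first
      | rw [h1.1 _ _ _ _ _ hl, h2.1 _ _ _ _ _ hl]; module
      | rw [h1.2.1 _ _ _ _ _ hl, h2.2.1 _ _ _ _ _ hl]; module
      | rw [h1.2.2 _ _ _ _ hl, h2.2.2 _ _ _ _ hl]; module

/-- Insertion is a derivation of products of cochains. -/
theorem ins_prod (b : ℤ → ℤ → W →ₗ[K] U →ₗ[K] Z) (n m k : ℤ) (r : List (Homog ℋ) → H)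
    (f : List (Homog ℋ) → W) (g : List (Homog ℋ) → U) :
    ins n r (prod b m k f g) = (-1 : K) ^ (k * n) • prod b (m + n) k (ins n r f) g +
      prod b m (k + n) f (ins n r g) := by
  funext l
  induction l generalizing n m k r f g with
  | nil => simp [ins, prod, fixFirst]
  | cons a l ih =>
    have h1 := ih (n + a.1) m k (fixFirst a r) f g
    have h2 := ih n (m + a.1) k r (fixFirst a f) g
    have h3 := ih n m (k + a.1) r f (fixFirst a g)
    rw [← add_assoc, ← add_assoc] at h1
    rw [add_right_comm] at h2 h3
    simp only [prod, ins, fixFirst_prod, fixFirst_ins, prod_add_left, prod_add_right,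
      prod_smul_left, prod_smul_right, ins_add_right, ins_smul_right, Pi.add_apply,
      Pi.smul_apply] at h1 h2 h3 ⊢
    rw [h1, h2, h3]
    simp only [negOne_zpow]
    cases ha : odd a.1 <;> cases hm : odd m <;> cases hn : odd n <;>
      cases hk : odd k <;> simp [ha, hm, hn, hk] <;> abel

/-- The pre-Lie identity for insertions. -/
theorem ins_ins {r t : List (Homog ℋ) → H} {f : List (Homog ℋ) → W}
    (hr : IsSymMultilinear r) (ht : IsSymMultilinear t) (hf : IsSymMultilinear f) (n k : ℤ) :
    ins k t (ins n r f) - ins (n + k) (ins k t r) f =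
      (-1 : K) ^ (n * k) • (ins n r (ins k t f) - ins (n + k) (ins n r t) f) := by
  funext l
  induction l generalizing n k r t f with
  | nil =>
    -- On the empty list the nested insertions cancel on each side, leaving `f` on the values of `r`
    -- and `t` in the two orders.
    have h := hf.swap [] [] (homogPart ℋ k (t [])) (homogPart ℋ n (r []))
    simp only [List.nil_append, homogPart_fst] at h
    simp only [ins, fixFirst, Pi.sub_apply, Pi.smul_apply, homogPart_fst, h, negOne_zpow,
      add_comm k n]
    cases hn : odd n <;> cases hk : odd k <;> simp [hn, hk]
  | cons a l ih =>
    have h1 := ih (hr.fixFirst a) ht hf (n + a.1) k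
    have h2 := ih hr (ht.fixFirst a) hf n (k + a.1)
    have h3 := ih hr ht (hf.fixFirst a) n k
    rw [add_right_comm] at h1
    rw [← add_assoc] at h2
    simp only [ins, fixFirst_ins, ins_add_right, ins_smul_right, hf.ins_add_left,
      hf.ins_smul_left, Pi.add_apply, Pi.sub_apply, Pi.smul_apply] at h1 h2 h3 ⊢
    rw [sub_eq_iff_eq_add] at h1 h2 h3
    rw [h1, h2, h3]
    simp only [negOne_zpow]
    cases ha : odd a.1 <;> cases hn : odd n <;> cases hk : odd k <;>
      simp [ha, hn, hk] <;> abel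

theorem comp_ins (φ : W →ₗ[K] U) (n : ℤ) (r : List (Homog ℋ) → H) (f : List (Homog ℋ) → W) :
    φ ∘ ins n r f = ins n r (φ ∘ f) := by
  funext l
  induction l generalizing n r f with
  | nil => rfl
  | cons a l ih =>
    simp only [Function.comp_apply] at ih
    simp only [Function.comp_apply, ins, map_add, map_smul, ih]
    rfl

theorem ins_fixFirst_idCochain (n : ℤ) (r : List (Homog ℋ) → H) (a : Homog ℋ) :
    ins n r (fixFirst a (idCochain ℋ)) = 0 := by
  funext l
  induction l generalizing n r with
  | nil => rfl
  | cons b l ih => simp [ins, fixFirst_fixFirst_idCochain, ih, ins_zero_right]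

/-- The derivative of the identity function along r is r. The degree hypothesis makes the projection
in `ins` harmless. -/
theorem HasDeg.ins_idCochain {n : ℤ} {r : List (Homog ℋ) → H} (hr : HasDeg ℋ n r) :
    HomotopyLie.ins n r (idCochain ℋ) = r := by
  funext l
  induction l generalizing n r with
  | nil =>
    change ((homogPart ℋ n (r [])).2 : H) = r []
    rw [homogPart_of_mem hr.nil_mem]
  | cons a l ih =>
    simp only [HomotopyLie.ins, ins_fixFirst_idCochain, ih (hr.fixFirst a)]
    simp [HomotopyLie.fixFirst]

end Insertion

section AbstractBracket

variable {K H W W' : Type*} [Field K] [AddCommGroup H] [Module K H] [AddCommGroup W] [Module K W]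
  [AddCommGroup W'] [Module K W']
  {ℋ : ℤ → Submodule K H} {𝒲 : ℤ → Submodule K W} {𝒲' : ℤ → Submodule K W'}

/-! ### Graded Lie structures whose bracket depends on degrees, and their actions -/

/-- A symmetric graded Lie algebra structure on the graded pieces `𝒲`, with a bracket which may
depend on the degrees of its arguments. -/
structure IsGradedLie (𝒲 : ℤ → Submodule K W) (b : ℤ → ℤ → W →ₗ[K] W →ₗ[K] W) : Prop where
  mem : ∀ {i j x y}, x ∈ 𝒲 i → y ∈ 𝒲 j → b i j x y ∈ 𝒲 (i + j + 1)
  symm : ∀ {i j x y}, x ∈ 𝒲 i → y ∈ 𝒲 j → b i j x y = (-1 : K) ^ (i * j) • b j i y x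
  leibniz : ∀ {i j k x y z}, x ∈ 𝒲 i → y ∈ 𝒲 j → z ∈ 𝒲 k →
    b i (j + k + 1) x (b j k y z) = (-1 : K) ^ (i + 1) • b (i + j + 1) k (b i j x y) z +
      (-1 : K) ^ ((i + 1) * (j + 1)) • b j (i + k + 1) y (b i k x z)

/-- An action of the graded Lie structure `b` on the symmetric graded Lie algebra `𝔥`, in terms of
elements. -/
structure IsGradedAction (𝒲 : ℤ → Submodule K W) (b : ℤ → ℤ → W →ₗ[K] W →ₗ[K] W)
    (𝔥 : SymGradedLie K ℋ) (a : W →ₗ[K] Module.End K H) : Prop where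
  mem : ∀ {i j x y}, x ∈ 𝒲 i → y ∈ ℋ j → a x y ∈ ℋ (i + j + 1)
  derivation : ∀ {i j k x y z}, x ∈ 𝒲 i → y ∈ ℋ j → z ∈ ℋ k →
    a x (𝔥.bracket y z) = (-1 : K) ^ (i + 1) • 𝔥.bracket (a x y) z +
      (-1 : K) ^ ((i + 1) * (j + 1)) • 𝔥.bracket y (a x z)
  comp : ∀ {i j k x y z}, x ∈ 𝒲 i → y ∈ 𝒲 j → z ∈ ℋ k →
    a x (a y z) = (-1 : K) ^ (i + 1) • a (b i j x y) z +
      (-1 : K) ^ ((i + 1) * (j + 1)) • a y (a x z)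

theorem SymGradedLie.isGradedLie {𝒢 : ℤ → Submodule K W} (𝔤 : SymGradedLie K 𝒢) :
    IsGradedLie 𝒢 fun _ _ => 𝔤.bracket :=
  ⟨𝔤.bracket_mem, 𝔤.bracket_symm, 𝔤.leibniz⟩

/-! ### The cochain of the bracket -/

/-- The bracket of `𝔥` as a cochain of degree `1`, concentrated on `S²(𝔥)`. -/
noncomputable def bracketCochain (𝔥 : SymGradedLie K ℋ) : List (Homog ℋ) → H :=
  (1 / 2 : K) • prod (fun _ _ => 𝔥.bracket) 0 0 (idCochain ℋ) (idCochain ℋ)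

theorem isSymMultilinear_bracketCochain (𝔥 : SymGradedLie K ℋ) :
    IsSymMultilinear (bracketCochain 𝔥) :=
  (IsSymMultilinear.prod _ isSymMultilinear_idCochain isSymMultilinear_idCochain).const_smul _

theorem hasDeg_bracketCochain (𝔥 : SymGradedLie K ℋ) : HasDeg ℋ 1 (bracketCochain 𝔥) := by
  have := (HasDeg.prod (fun _ _ => 𝔥.bracket) 𝔥.bracket_mem (hasDeg_idCochain (ℋ := ℋ))
    hasDeg_idCochain).smul (1 / 2 : K)
  rwa [zero_add, zero_add] at this

section

variable [CharZero K]

theorem bracketCochain_nil (𝔥 : SymGradedLie K ℋ) : bracketCochain 𝔥 [] = 0 := by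
  simp [bracketCochain, prod, idCochain]

/-- The two unshuffles of a pair contribute equally by graded symmetry, which cancels the factor
1/2. -/
theorem bracketCochain_pair (𝔥 : SymGradedLie K ℋ) (x y : Homog ℋ) :
    bracketCochain 𝔥 [x, y] = 𝔥.bracket x.2 y.2 := by
  have h := 𝔥.bracket_symm x.2.2 y.2.2
  simp only [bracketCochain, Pi.smul_apply, prod, fixFirst, idCochain, map_zero, smul_zero,
    zero_mul, zpow_zero, one_smul, LinearMap.zero_apply, zero_add, add_zero]
  rw [← h]
  module

theorem fixFirst_bracketCochain (𝔥 : SymGradedLie K ℋ) (x y : Homog ℋ) (l : List (Homog ℋ)) :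
    bracketCochain 𝔥 [x] = 0 ∧ (l ≠ [] → bracketCochain 𝔥 (x :: y :: l) = 0) := by
  refine ⟨by simp [bracketCochain, prod, idCochain, fixFirst], fun hl => ?_⟩
  obtain ⟨z, l, rfl⟩ := List.exists_cons_of_ne_nil hl
  have h0 : ∀ a b : Homog ℋ, fixFirst b (fixFirst a (idCochain ℋ)) = 0 := fun a b => rfl
  simp [bracketCochain, prod, h0, prod_zero_left, prod_zero_right]

variable [DirectSum.Decomposition ℋ]

theorem two_smul_bracketCochain (𝔥 : SymGradedLie K ℋ) :
    prod (fun _ _ => 𝔥.bracket) 0 0 (idCochain ℋ) (idCochain ℋ) =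
      (2 : K) • bracketCochain 𝔥 := by
  rw [bracketCochain, smul_smul]; norm_num

/-- By the derivation rule q·q is a multiple of [x,[x,x]], which the Jacobi identity with three
equal arguments kills. -/
theorem ins_bracketCochain_self (𝔥 : SymGradedLie K ℋ) :
    ins 1 (bracketCochain 𝔥) (bracketCochain 𝔥) = 0 := by
  have hid := hasDeg_idCochain (ℋ := ℋ)
  have hq := hasDeg_bracketCochain 𝔥
  have h1 := ins_prod (fun _ _ => 𝔥.bracket) 1 0 0 (bracketCochain 𝔥) (idCochain ℋ) (idCochain ℋ)
  have h2 := prod_comm (fun _ _ => 𝔥.bracket) (fun _ _ => 𝔥.bracket) 𝔥.bracket_symm hq hid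
  have h3 := prod_leibniz (b₁ := fun _ _ => 𝔥.bracket) (b₂ := fun _ _ => 𝔥.bracket)
    (b₃ := fun _ _ => 𝔥.bracket) (b₄ := fun _ _ => 𝔥.bracket) (b₅ := fun _ _ => 𝔥.bracket)
    (b₆ := fun _ _ => 𝔥.bracket) 𝔥.leibniz hid hid hid
  rw [two_smul_bracketCochain, ins_smul_right, hq.ins_idCochain] at h1
  simp only [two_smul_bracketCochain, prod_smul_left, prod_smul_right] at h3
  simp only [zero_add, add_zero, zero_mul, mul_zero, zpow_zero, one_smul, zpow_one, mul_one]
    at h1 h2 h3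
  rw [h2] at h1 h3
  have h4 : prod (fun _ _ => 𝔥.bracket) 0 1 (idCochain ℋ) (bracketCochain 𝔥) = 0 := by
    -- With E = [x,q] and [x,x] = 2q, the Jacobi identity reads 2E = -2E - 2E.
    have : (6 : K) • prod (fun _ _ => 𝔥.bracket) 0 1 (idCochain ℋ) (bracketCochain 𝔥) = 0 := by
      linear_combination (norm := module) h3
    exact (smul_eq_zero.1 this).resolve_left (by norm_num)
  rw [h4, add_zero] at h1
  exact (smul_eq_zero.1 h1).resolve_left (by norm_num)

/-- The pre-Lie identity for the odd field q against itself gives 2 q·(q·f) = 2 (q·q)·f, and q·q =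
0. -/
theorem ins_bracketCochain_ins_bracketCochain (𝔥 : SymGradedLie K ℋ) {f : List (Homog ℋ) → W}
    (hf : IsSymMultilinear f) :
    ins 1 (bracketCochain 𝔥) (ins 1 (bracketCochain 𝔥) f) = 0 := by
  have hq := isSymMultilinear_bracketCochain 𝔥
  have h := ins_ins hq hq hf 1 1
  rw [ins_bracketCochain_self, hf.ins_zero_left] at h
  have : (2 : K) • ins 1 (bracketCochain 𝔥) (ins 1 (bracketCochain 𝔥) f) = 0 := by
    simp only [mul_one, zpow_one] at h
    linear_combination (norm := module) h
  exact (smul_eq_zero.1 this).resolve_left (by norm_num)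

end

/-! ### The vector field of a cochain, and the bracket -/

/-- The `H`-valued cochain `x ↦ a(f(x)) x` of degree `n + 1` for `f` of degree `n`. -/
def vectorField (a : W →ₗ[K] Module.End K H) (n : ℤ) (f : List (Homog ℋ) → W) :
    List (Homog ℋ) → H :=
  prod (fun _ _ => a) n 0 f (idCochain ℋ)

theorem vectorField_add (a : W →ₗ[K] Module.End K H) (n : ℤ) (f g : List (Homog ℋ) → W) :
    vectorField a n (f + g) = vectorField a n f + vectorField a n g := prod_add_left _ _ _ _ _ _

theorem vectorField_smul (a : W →ₗ[K] Module.End K H) (n : ℤ) (c : K) (f : List (Homog ℋ) → W) :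
    vectorField a n (c • f) = c • vectorField a n f := prod_smul_left _ _ _ _ _ _

theorem IsSymMultilinear.vectorField {a : W →ₗ[K] Module.End K H} {n : ℤ}
    {f : List (Homog ℋ) → W} (hf : IsSymMultilinear f) :
    IsSymMultilinear (vectorField a n f) :=
  IsSymMultilinear.prod _ hf isSymMultilinear_idCochain

variable {b : ℤ → ℤ → W →ₗ[K] W →ₗ[K] W} {𝔥 : SymGradedLie K ℋ} {a : W →ₗ[K] Module.End K H}

theorem HasDeg.vectorField (ha : IsGradedAction 𝒲 b 𝔥 a) {n : ℤ} {f : List (Homog ℋ) → W}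
    (hf : HasDeg 𝒲 n f) : HasDeg ℋ (n + 1) (vectorField a n f) := by
  have := HasDeg.prod (fun _ _ => a) ha.mem hf (hasDeg_idCochain (ℋ := ℋ))
  rwa [add_zero] at this

variable [DirectSum.Decomposition ℋ]

/-- Differentiate a(f(x))x along X_g: the derivative of f gives the first term, that of x gives
a(f)(a(g)x), which is rewritten by compatibility of the action with brackets. -/
theorem ins_vectorField (ha : IsGradedAction 𝒲 b 𝔥 a) {m n : ℤ} {f g : List (Homog ℋ) → W}
    (hf : HasDeg 𝒲 m f) (hg : HasDeg 𝒲 n g) :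
    ins (n + 1) (vectorField a n g) (vectorField a m f) =
      vectorField a (m + n + 1) (ins (n + 1) (vectorField a n g) f) +
      (-1 : K) ^ (m + 1) • vectorField a (m + n + 1) (prod b m n f g) +
      (-1 : K) ^ ((m + 1) * (n + 1)) • prod (fun _ _ => a) n (m + 1) g (vectorField a m f) := by
  have h1 := ins_prod (fun _ _ => a) (n + 1) m 0 (vectorField a n g) f (idCochain ℋ)
  have h2 := prod_leibniz (b₁ := fun _ _ => a) (b₂ := fun _ _ => a) (b₃ := fun _ _ => a) (b₄ := b)
    (b₅ := fun _ _ => a) (b₆ := fun _ _ => a) ha.comp hf hg (hasDeg_idCochain (ℋ := ℋ))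
  rw [(hg.vectorField ha).ins_idCochain] at h1
  simp only [zero_mul, zpow_zero, one_smul, zero_add, add_zero, ← add_assoc] at h1 h2
  simp only [vectorField, ← add_assoc] at h1 h2 ⊢
  rw [h1, h2, ← add_assoc]

/-- Differentiate a(g(x))x along q. Differentiating x gives a(g)q, and because a(g) is a derivation
of [x,x] this is, up to sign, the derivative of q along X_g. The identity is obtained doubled, since
[x,x] = 2q. -/
theorem ins_bracketCochain_vectorField [CharZero K] (ha : IsGradedAction 𝒲 b 𝔥 a) {n : ℤ}
    {g : List (Homog ℋ) → W} (hg : HasDeg 𝒲 n g) :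
    ins 1 (bracketCochain 𝔥) (vectorField a n g) =
      vectorField a (n + 1) (ins 1 (bracketCochain 𝔥) g) +
      (-1 : K) ^ (n + 1) • ins (n + 1) (vectorField a n g) (bracketCochain 𝔥) := by
  have hid := hasDeg_idCochain (ℋ := ℋ)
  have h1 := ins_prod (fun _ _ => a) 1 n 0 (bracketCochain 𝔥) g (idCochain ℋ)
  have h2 := ins_prod (fun _ _ => 𝔥.bracket) (n + 1) 0 0 (vectorField a n g) (idCochain ℋ)
    (idCochain ℋ)
  have h3 := prod_leibniz (b₁ := fun _ _ => a) (b₂ := fun _ _ => 𝔥.bracket)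
    (b₃ := fun _ _ => 𝔥.bracket) (b₄ := fun _ _ => a)
    (b₅ := fun _ _ => 𝔥.bracket) (b₆ := fun _ _ => a) ha.derivation hg hid hid
  rw [(hasDeg_bracketCochain 𝔥).ins_idCochain] at h1
  rw [(hg.vectorField ha).ins_idCochain, two_smul_bracketCochain, ins_smul_right] at h2
  rw [two_smul_bracketCochain, prod_smul_right] at h3
  simp only [zero_mul, mul_zero, mul_one, zpow_zero, one_smul, zero_add, add_zero] at h1 h2 h3
  simp only [vectorField] at h1 h2 h3 ⊢
  rw [h1]
  congr 1
  have : (2 : K) • prod (fun _ _ => a) n 1 g (bracketCochain 𝔥) = (2 : K) •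
      (-1 : K) ^ (n + 1) • ins (n + 1) (prod (fun _ _ => a) n 0 g (idCochain ℋ))
        (bracketCochain 𝔥) := by
    rw [smul_comm, h2, h3, smul_add]
  exact smul_right_injective _ (two_ne_zero (α := K)) this

/-- The bracket of cochains of degrees `m` and `n`. -/
def cochainBracket (b : ℤ → ℤ → W →ₗ[K] W →ₗ[K] W) (a : W →ₗ[K] Module.End K H) (m n : ℤ)
    (f g : List (Homog ℋ) → W) : List (Homog ℋ) → W :=
  -ins (n + 1) (vectorField a n g) f
    + (-1 : K) ^ ((m + 1) * (n + 1)) • ins (m + 1) (vectorField a m f) g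
    - (-1 : K) ^ (m + 1) • prod b m n f g

/-- The differential of cochains of degree `n`. -/
noncomputable def cochainDiff (𝔥 : SymGradedLie K ℋ) (n : ℤ) (f : List (Homog ℋ) → W) :
    List (Homog ℋ) → W :=
  (-1 : K) ^ (n + 1) • ins 1 (bracketCochain 𝔥) f

theorem HasDeg.cochainDiff (𝔥 : SymGradedLie K ℋ) {n : ℤ} {f : List (Homog ℋ) → W}
    (hf : HasDeg 𝒲 n f) : HasDeg 𝒲 (n + 1) (cochainDiff 𝔥 n f) := (hf.ins _ _).smul _

theorem IsSymMultilinear.cochainDiff (𝔥 : SymGradedLie K ℋ) {n : ℤ} {f : List (Homog ℋ) → W}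
    (hf : IsSymMultilinear f) : IsSymMultilinear (cochainDiff 𝔥 n f) :=
  ((isSymMultilinear_bracketCochain 𝔥).ins hf _).const_smul _

theorem HasDeg.cochainBracket (hb : IsGradedLie 𝒲 b) (a : W →ₗ[K] Module.End K H) {m n : ℤ}
    {f g : List (Homog ℋ) → W} (hf : HasDeg 𝒲 m f) (hg : HasDeg 𝒲 n g) :
    HasDeg 𝒲 (m + n + 1) (cochainBracket b a m n f g) := by
  have h1 := hf.ins (n + 1) (HomotopyLie.vectorField a n g)
  have h2 := hg.ins (m + 1) (HomotopyLie.vectorField a m f)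
  have h3 := HasDeg.prod b hb.mem hf hg
  rw [← add_assoc] at h1
  rw [← add_assoc, add_comm n m] at h2
  exact fun l => sub_mem (add_mem (neg_mem (h1 l)) (h2.smul _ l)) (h3.smul _ l)

theorem IsSymMultilinear.cochainBracket {m n : ℤ} {f g : List (Homog ℋ) → W}
    (hf : IsSymMultilinear f) (hg : IsSymMultilinear g) :
    IsSymMultilinear (cochainBracket b a m n f g) := by
  have h1 := (hg.vectorField (a := a) (n := n)).ins hf (n + 1)
  have h2 := (hf.vectorField (a := a) (n := m)).ins hg (m + 1)
  have h3 := IsSymMultilinear.prod b (m := m) (n := n) hf hg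
  convert ((h1.const_smul (-1)).sum (h2.const_smul ((-1) ^ ((m + 1) * (n + 1))))).sum
    (h3.const_smul (-(-1) ^ (m + 1))) using 1
  rw [HomotopyLie.cochainBracket]
  module

/-! ### Graded Lie axioms of the cochain bracket and compatibility with the differential -/

theorem cochainBracket_skew (hb : IsGradedLie 𝒲 b) {m n : ℤ} {f g : List (Homog ℋ) → W}
    (hf : HasDeg 𝒲 m f) (hg : HasDeg 𝒲 n g) :
    cochainBracket b a m n f g =
      -((-1 : K) ^ ((m + 1) * (n + 1)) • cochainBracket b a n m g f) := by
  have h := prod_comm b b hb.symm hf hg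
  simp only [cochainBracket]
  rw [h]
  simp only [negOne_zpow]
  cases hm : odd m <;> cases hn : odd n <;> simp [hm, hn] <;> abel

/-- The term a(g)X_f occurs in both iterated derivatives and cancels in their commutator. What
remains is the vector field of the three terms of the bracket. -/
theorem vectorField_cochainBracket (ha : IsGradedAction 𝒲 b 𝔥 a) {m n : ℤ}
    {f g : List (Homog ℋ) → W} (hf : HasDeg 𝒲 m f) (hg : HasDeg 𝒲 n g) :
    vectorField a (m + n + 1) (cochainBracket b a m n f g) =
      -ins (n + 1) (vectorField a n g) (vectorField a m f) +
        (-1 : K) ^ ((m + 1) * (n + 1)) • ins (m + 1) (vectorField a m f) (vectorField a n g) := by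
  have h1 := ins_vectorField ha hf hg
  have h2 := ins_prod (fun _ _ => a) (m + 1) n 0 (vectorField a m f) g (idCochain ℋ)
  rw [(hf.vectorField ha).ins_idCochain] at h2
  simp only [zero_mul, zpow_zero, one_smul, zero_add, add_zero, ← add_assoc, add_comm n m] at h2
  rw [show prod (fun _ _ => a) n 0 g (idCochain ℋ) = vectorField a n g from rfl,
    show prod (fun _ _ => a) (m + n + 1) 0 (ins (m + 1) (vectorField a m f) g) (idCochain ℋ) =
      vectorField a (m + n + 1) (ins (m + 1) (vectorField a m f) g) from rfl] at h2
  rw [h1, h2, cochainBracket, sub_eq_add_neg, vectorField_add, vectorField_add, ← neg_one_smul K,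
    ← neg_one_smul K (_ • prod b m n f g), vectorField_smul, vectorField_smul, vectorField_smul,
    vectorField_smul]
  module

/-- By the pre-Lie identity the commutator of two vector fields acts on cochains as the commutator
of the two derivatives. -/
theorem ins_vectorField_cochainBracket (ha : IsGradedAction 𝒲 b 𝔥 a) {m n : ℤ}
    {f g : List (Homog ℋ) → W} {h : List (Homog ℋ) → W'} (hf : HasDeg 𝒲 m f)
    (hg : HasDeg 𝒲 n g) (hf' : IsSymMultilinear f) (hg' : IsSymMultilinear g)
    (hh : IsSymMultilinear h) :
    ins (m + n + 1 + 1) (vectorField a (m + n + 1) (cochainBracket b a m n f g)) h =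
      -ins (n + 1) (vectorField a n g) (ins (m + 1) (vectorField a m f) h) +
        (-1 : K) ^ ((m + 1) * (n + 1)) •
          ins (m + 1) (vectorField a m f) (ins (n + 1) (vectorField a n g) h) := by
  have h1 := ins_ins (hf'.vectorField (a := a) (n := m)) (hg'.vectorField (a := a) (n := n)) hh
    (m + 1) (n + 1)
  rw [vectorField_cochainBracket ha hf hg, hh.ins_add_left, ← neg_one_smul K, hh.ins_smul_left,
    hh.ins_smul_left, show m + n + 1 + 1 = m + 1 + (n + 1) by ring]
  linear_combination (norm := module) h1

/-- The iterated derivatives cancel by the commutator formula for vector fields, the derivatives of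
products by the derivation rule, and the purely algebraic terms by the Jacobi identity of the
coefficients. -/
theorem cochainBracket_jacobi (hb : IsGradedLie 𝒲 b) (ha : IsGradedAction 𝒲 b 𝔥 a) {m n k : ℤ}
    {f g h : List (Homog ℋ) → W} (hf : HasDeg 𝒲 m f) (hg : HasDeg 𝒲 n g) (hh : HasDeg 𝒲 k h)
    (hf' : IsSymMultilinear f) (hg' : IsSymMultilinear g) (hh' : IsSymMultilinear h) :
    cochainBracket b a m (n + k + 1) f (cochainBracket b a n k g h) =
      cochainBracket b a (m + n + 1) k (cochainBracket b a m n f g) h +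
        (-1 : K) ^ ((m + 1) * (n + 1)) •
          cochainBracket b a n (m + k + 1) g (cochainBracket b a m k f h) := by
  -- Only the outer brackets are to be expanded at first: the vector fields of the inner ones must
  -- stay intact for the commutator formula.
  have hB : ∀ (i j : ℤ) (e e' : List (Homog ℋ) → W), cochainBracket b a i j e e' =
      -ins (j + 1) (vectorField a j e') e
      + (-1 : K) ^ ((i + 1) * (j + 1)) • ins (i + 1) (vectorField a i e) e'
      - (-1 : K) ^ (i + 1) • prod b i j e e' := fun _ _ _ _ => rfl
  rw [hB m (n + k + 1), hB (m + n + 1) k, hB n (m + k + 1),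
    ins_vectorField_cochainBracket ha hg hh hg' hh' hf',
    ins_vectorField_cochainBracket ha hf hg hf' hg' hh',
    ins_vectorField_cochainBracket ha hf hh hf' hh' hg']
  have e1 := ins_prod b (m + 1) n k (vectorField a m f) g h
  have e2 := ins_prod b (n + 1) m k (vectorField a n g) f h
  have e3 := ins_prod b (k + 1) m n (vectorField a k h) f g
  have e4 := prod_leibniz hb.leibniz hf hg hh
  -- The derivative of [f,g] along X_h has X_h·f on the left, whereas the bracket of g with ⟦f,h⟧
  -- has it on the right.
  have e5 := prod_comm b b hb.symm (hf.ins (k + 1) (vectorField a k h)) hg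
  rw [e5] at e3
  rw [show n + (m + 1) = m + n + 1 by ring, show k + (m + 1) = m + k + 1 by ring] at e1
  rw [show m + (n + 1) = m + n + 1 by ring, show k + (n + 1) = n + k + 1 by ring] at e2
  rw [show m + (k + 1) = m + k + 1 by ring, show n + (k + 1) = n + k + 1 by ring] at e3
  simp only [cochainBracket, sub_eq_add_neg, ← neg_one_smul K (_ : List (Homog ℋ) → W),
    ins_add_right, ins_smul_right,
    prod_add_left, prod_add_right, prod_smul_left, prod_smul_right]
  rw [e1, e2, e3, e4]
  simp only [negOne_zpow]
  cases hm : odd m <;> cases hn : odd n <;> cases hk : odd k <;> simp [hm, hn, hk] <;> abel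

theorem cochainDiff_cochainDiff [CharZero K] (𝔥 : SymGradedLie K ℋ) {n : ℤ}
    {f : List (Homog ℋ) → W} (hf : IsSymMultilinear f) :
    cochainDiff 𝔥 (n + 1) (cochainDiff 𝔥 n f) = 0 := by
  rw [cochainDiff, cochainDiff, ins_smul_right, ins_bracketCochain_ins_bracketCochain 𝔥 hf,
    smul_zero, smul_zero]

/-- The pre-Lie identity for q and X_g, with q·X_g expanded: the terms (X_g·q)·f cancel. -/
theorem ins_bracketCochain_ins_vectorField [CharZero K] (ha : IsGradedAction 𝒲 b 𝔥 a) {n : ℤ}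
    {g : List (Homog ℋ) → W} {f : List (Homog ℋ) → W'} (hg : HasDeg 𝒲 n g)
    (hg' : IsSymMultilinear g) (hf : IsSymMultilinear f) :
    ins 1 (bracketCochain 𝔥) (ins (n + 1) (vectorField a n g) f) =
      ins (n + 1 + 1) (vectorField a (n + 1) (ins 1 (bracketCochain 𝔥) g)) f +
        (-1 : K) ^ (n + 1) • ins (n + 1) (vectorField a n g) (ins 1 (bracketCochain 𝔥) f) := by
  have h := ins_ins (hg'.vectorField (a := a) (n := n)) (isSymMultilinear_bracketCochain 𝔥) hf
    (n + 1) 1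
  rw [ins_bracketCochain_vectorField ha hg, hf.ins_add_left, hf.ins_smul_left, mul_one] at h
  linear_combination (norm := module) h

theorem cochainDiff_cochainBracket [CharZero K] (ha : IsGradedAction 𝒲 b 𝔥 a) {m n : ℤ}
    {f g : List (Homog ℋ) → W} (hf : HasDeg 𝒲 m f) (hg : HasDeg 𝒲 n g)
    (hf' : IsSymMultilinear f) (hg' : IsSymMultilinear g) :
    cochainDiff 𝔥 (m + n + 1) (cochainBracket b a m n f g) =
      cochainBracket b a (m + 1) n (cochainDiff 𝔥 m f) g +
        (-1 : K) ^ (m + 1) • cochainBracket b a m (n + 1) f (cochainDiff 𝔥 n g) := by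
  have e1 := ins_bracketCochain_ins_vectorField ha hg hg' hf'
  have e2 := ins_bracketCochain_ins_vectorField ha hf hf' hg'
  have e3 := ins_prod b 1 m n (bracketCochain 𝔥) f g
  simp only [cochainDiff, cochainBracket, sub_eq_add_neg,
    ← neg_one_smul K (_ : List (Homog ℋ) → W), ins_add_right, ins_smul_right,
    prod_smul_left, prod_smul_right, vectorField_smul, hf'.ins_smul_left, hg'.ins_smul_left]
  rw [e1, e2, e3]
  simp only [negOne_zpow]
  cases hm : odd m <;> cases hn : odd n <;> simp [hm, hn] <;> abel

/-! ### Change of coefficients -/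

theorem comp_cochainDiff (𝔥 : SymGradedLie K ℋ) (φ : W →ₗ[K] W') (n : ℤ)
    (f : List (Homog ℋ) → W) : φ ∘ cochainDiff 𝔥 n f = cochainDiff 𝔥 n (φ ∘ f) := by
  rw [cochainDiff, cochainDiff, ← comp_ins]
  funext l
  simp

theorem comp_cochainBracket {b' : ℤ → ℤ → W' →ₗ[K] W' →ₗ[K] W'} {a' : W' →ₗ[K] Module.End K H}
    (φ : W →ₗ[K] W') (hb : ∀ {i j x y}, x ∈ 𝒲 i → y ∈ 𝒲 j → φ (b i j x y) = b' i j (φ x) (φ y))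
    (ha : a' ∘ₗ φ = a) {m n : ℤ} {f g : List (Homog ℋ) → W} (hf : HasDeg 𝒲 m f)
    (hg : HasDeg 𝒲 n g) :
    φ ∘ cochainBracket b a m n f g = cochainBracket b' a' m n (φ ∘ f) (φ ∘ g) := by
  -- A cochain and its image under φ have the same vector field, because the actions are intertwined
  -- by φ; only the product term needs φ to respect brackets.
  have hv : ∀ {k : ℤ} {e : List (Homog ℋ) → W}, HasDeg 𝒲 k e →
      vectorField a' k (φ ∘ e) = vectorField a k e := fun he =>
    (comp_prod (fun _ _ => a) (fun _ _ => a') φ LinearMap.id LinearMap.id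
      (fun {i j x y} _ _ => by rw [← ha]; rfl) he hasDeg_idCochain).symm
  rw [cochainBracket, cochainBracket, hv hf, hv hg, ← comp_ins, ← comp_ins,
    ← comp_prod b b' φ φ φ hb hf hg]
  funext l
  simp

end AbstractBracket

/-! ### Permutations of `Fin (p + 1)` in terms of permutations of `Fin p` -/

section InsPerm

variable {p : ℕ}

/-- The permutation which takes `k` to `0`, and the other elements to nonzero elements as `σ`
does. -/
def insPerm (k : Fin (p + 1)) (σ : Equiv.Perm (Fin p)) : Equiv.Perm (Fin (p + 1)) :=
  (finSuccEquiv' k).trans ((Equiv.optionCongr σ).trans (finSuccEquiv' 0).symm)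

@[simp] theorem insPerm_self (k : Fin (p + 1)) (σ : Equiv.Perm (Fin p)) : insPerm k σ k = 0 := by
  simp [insPerm]

@[simp] theorem insPerm_succAbove (k : Fin (p + 1)) (σ : Equiv.Perm (Fin p)) (i : Fin p) :
    insPerm k σ (k.succAbove i) = (σ i).succ := by
  simp [insPerm]

@[simp] theorem insPerm_zero_succ (σ : Equiv.Perm (Fin p)) (i : Fin p) :
    insPerm 0 σ i.succ = (σ i).succ := by
  rw [← Fin.zero_succAbove, insPerm_succAbove]

/-- Injective because k is the preimage of 0, and then bijective by counting: (p+1)·p! = (p+1)!. -/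
theorem insPerm_bijective :
    Function.Bijective fun x : Fin (p + 1) × Equiv.Perm (Fin p) => insPerm x.1 x.2 := by
  rw [Fintype.bijective_iff_injective_and_card]
  refine ⟨?_, by simp [Fintype.card_perm, Nat.factorial_succ]⟩
  rintro ⟨k, σ⟩ ⟨k', σ'⟩ h
  have h : insPerm k σ = insPerm k' σ' := h
  have hk : k = k' := by
    apply (insPerm k' σ').injective
    rw [← h, insPerm_self, h, insPerm_self]
  subst hk
  congr 1
  ext i : 1
  have := congrArg (fun τ => τ (k.succAbove i)) h
  simpa using this

theorem sum_perm_succ {Z : Type*} [AddCommMonoid Z] (F : Equiv.Perm (Fin (p + 1)) → Z) :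
    ∑ σ, F σ = ∑ k, ∑ σ, F (insPerm k σ) := by
  rw [← Fintype.sum_prod_type']
  exact (Function.Bijective.sum_comp insPerm_bijective F).symm

theorem val_succAbove (k : Fin (p + 1)) (i : Fin p) :
    (k.succAbove i : ℕ) = if (i : ℕ) < k then (i : ℕ) else i + 1 := by
  simp only [Fin.succAbove, Fin.lt_def, Fin.val_castSucc]
  split <;> simp

theorem ofFn_insPerm {X : Type*} (x : Fin (p + 1) → X) (k : Fin (p + 1))
    (σ : Equiv.Perm (Fin p)) :
    List.ofFn (fun i => x (insPerm k σ i)) =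
      (List.ofFn fun i => x (σ i).succ).take k ++
        x 0 :: (List.ofFn fun i => x (σ i).succ).drop k := by
  have hk := k.is_le
  apply List.ext_getElem
  · simp; omega
  · intro n h1 h2
    simp only [List.length_ofFn] at h1
    rw [List.getElem_ofFn]
    rcases Fin.eq_self_or_eq_succAbove k ⟨n, h1⟩ with h | ⟨i, h⟩
    · rw [h, insPerm_self]
      have : n = k := by rw [← h]
      subst this
      rw [List.getElem_append_right (by simp)]
      simp [hk]
    · rw [h, insPerm_succAbove]
      have hn : n = (k.succAbove i : ℕ) := by rw [← h]
      rw [val_succAbove] at hn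
      split_ifs at hn with hi
      · subst hn
        rw [List.getElem_append_left (by simp; omega)]
        simp
      · subst hn
        rw [List.getElem_append_right (by simp; omega)]
        have : (i : ℕ) + 1 - ((List.ofFn fun i => x (σ i).succ).take k).length =
            (i - k) + 1 := by simp; omega
        simp only [this, List.getElem_cons_succ, List.getElem_drop, List.getElem_ofFn]
        congr 3
        apply Fin.ext
        change (i : ℕ) = k + (i - k)
        omega

/-! ### Shuffles classified by the position of 0 -/

theorem mem_shuffles {a : ℕ} {σ : Equiv.Perm (Fin p)} :
    σ ∈ shuffles p a ↔ ∀ i j : Fin p, i < j → ((j : ℕ) < a ∨ a ≤ (i : ℕ)) → σ i < σ j := by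
  simp [shuffles]

theorem mem_shuffles₃ {a : ℕ} {σ : Equiv.Perm (Fin p)} :
    σ ∈ shuffles₃ p a ↔ ∀ i j : Fin p, i < j → ((j : ℕ) < a ∨ a < (i : ℕ)) → σ i < σ j := by
  simp [shuffles₃]

/-- A permutation `insPerm k σ` is increasing on the blocks given by `R'` iff `k` is minimal in its
block and `σ` is increasing on the blocks given by `R`. -/
theorem insPerm_increasing_iff {R' : ℕ → ℕ → Prop} {R : ℕ → ℕ → Prop} (k : Fin (p + 1))
    (σ : Equiv.Perm (Fin p)) (hk : ∀ i < (k : ℕ), ¬R' i k)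
    (hR : ∀ i j : Fin p, i < j → (R' (k.succAbove i) (k.succAbove j) ↔ R i j)) :
    (∀ i j : Fin (p + 1), i < j → R' i j → insPerm k σ i < insPerm k σ j) ↔
      ∀ i j : Fin p, i < j → R i j → σ i < σ j := by
  constructor
  · intro h i j hij hr
    have := h (k.succAbove i) (k.succAbove j) ((Fin.strictMono_succAbove k) hij)
      ((hR i j hij).2 hr)
    simpa using this
  · intro h i j hij hr
    rcases Fin.eq_self_or_eq_succAbove k i with rfl | ⟨i, rfl⟩
    · rcases Fin.eq_self_or_eq_succAbove i j with rfl | ⟨j, rfl⟩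
      · exact absurd hij (lt_irrefl _)
      · simp
    · rcases Fin.eq_self_or_eq_succAbove k j with rfl | ⟨j, rfl⟩
      · exact absurd hr (hk _ hij)
      · have hij' := (Fin.strictMono_succAbove k).lt_iff_lt.1 hij
        simpa using h i j hij' ((hR i j hij').1 hr)

theorem insPerm_not_increasing {R' : ℕ → ℕ → Prop} (k : Fin (p + 1))
    (σ : Equiv.Perm (Fin p)) (i : ℕ) (hi : i < (k : ℕ)) (hk : R' i k) :
    ¬∀ i j : Fin (p + 1), i < j → R' i j → insPerm k σ i < insPerm k σ j := fun h => by
  have := h ⟨i, by omega⟩ k hi hk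
  simp at this

/-- The value 0 must open its block, so it sits at position 0 of a nonempty first block or at
position a. Deleting it leaves a shuffle with that block shortened. -/
theorem insPerm_mem_shuffles {a : ℕ} (k : Fin (p + 1)) (σ : Equiv.Perm (Fin p)) :
    insPerm k σ ∈ shuffles (p + 1) a ↔
      (k = 0 ∧ 0 < a ∧ σ ∈ shuffles p (a - 1)) ∨ ((k : ℕ) = a ∧ σ ∈ shuffles p a) := by
  simp only [mem_shuffles, Fin.ext_iff, Fin.val_zero]
  by_cases h0 : (k : ℕ) = 0 ∧ 0 < a
  · rw [insPerm_increasing_iff (R := fun i j => j < a - 1 ∨ a - 1 ≤ i)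
      (R' := fun i j => j < a ∨ a ≤ i)]
    · simp only [h0, true_and]
      constructor
      · exact Or.inl
      · rintro (h | ⟨h, -⟩)
        · exact h
        · omega
    · omega
    · intro i j hij
      simp only [val_succAbove]
      split_ifs <;> omega
  by_cases h1 : (k : ℕ) = a
  · rw [insPerm_increasing_iff (R := fun i j => j < a ∨ a ≤ i) (R' := fun i j => j < a ∨ a ≤ i)]
    · simp only [h1, true_and]
      constructor
      · exact Or.inr
      · rintro (⟨h, h', -⟩ | h)
        · omega
        · exact h
    · omega
    · intro i j hij
      simp only [val_succAbove]
      have : (i : ℕ) < j := hij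
      split_ifs <;> omega
  · refine iff_of_false ?_ (by rintro (⟨h, h', -⟩ | ⟨h, -⟩) <;> omega)
    -- Here k > 0 and k does not open a block, so its predecessor lies in the same block and has a
    -- larger value.
    exact insPerm_not_increasing (R' := fun i j => j < a ∨ a ≤ i) k σ (k - 1) (by omega) (by omega)

/-- Now there are three blocks to open. If 0 fills the middle slot, the other two blocks form an
ordinary shuffle, which is why both kinds of shuffles enter the recursion. -/
theorem insPerm_mem_shuffles₃ {a : ℕ} (k : Fin (p + 1)) (σ : Equiv.Perm (Fin p)) :
    insPerm k σ ∈ shuffles₃ (p + 1) a ↔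
      (k = 0 ∧ 0 < a ∧ σ ∈ shuffles₃ p (a - 1)) ∨ ((k : ℕ) = a ∧ σ ∈ shuffles p a) ∨
        ((k : ℕ) = a + 1 ∧ σ ∈ shuffles₃ p a) := by
  simp only [mem_shuffles, mem_shuffles₃, Fin.ext_iff, Fin.val_zero]
  by_cases h0 : (k : ℕ) = 0 ∧ 0 < a
  · rw [insPerm_increasing_iff (R := fun i j => j < a - 1 ∨ a - 1 < i)
      (R' := fun i j => j < a ∨ a < i)]
    · simp only [h0, true_and]
      constructor
      · exact Or.inl
      · rintro (h | ⟨h, -⟩ | ⟨h, -⟩)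
        · exact h
        · omega
        · omega
    · omega
    · intro i j hij
      simp only [val_succAbove]
      split_ifs <;> omega
  by_cases h1 : (k : ℕ) = a
  · rw [insPerm_increasing_iff (R := fun i j => j < a ∨ a ≤ i) (R' := fun i j => j < a ∨ a < i)]
    · simp only [h1, true_and]
      constructor
      · exact fun h => Or.inr (Or.inl h)
      · rintro (⟨h, h', -⟩ | h | ⟨h, -⟩)
        · omega
        · exact h
        · omega
    · omega
    · intro i j hij
      simp only [val_succAbove]
      have : (i : ℕ) < j := hij
      split_ifs <;> omega
  by_cases h2 : (k : ℕ) = a + 1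
  · rw [insPerm_increasing_iff (R := fun i j => j < a ∨ a < i) (R' := fun i j => j < a ∨ a < i)]
    · simp only [h2, true_and]
      constructor
      · exact fun h => Or.inr (Or.inr h)
      · rintro (⟨h, h', -⟩ | ⟨h, -⟩ | h)
        · omega
        · omega
        · exact h
    · omega
    · intro i j hij
      simp only [val_succAbove]
      have : (i : ℕ) < j := hij
      split_ifs <;> omega
  · refine iff_of_false ?_ (by rintro (⟨h, h', -⟩ | ⟨h, -⟩ | ⟨h, -⟩) <;> omega)
    exact insPerm_not_increasing (R' := fun i j => j < a ∨ a < i) k σ (k - 1) (by omega) (by omega)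

end InsPerm

/-! ### Koszul signs and sums over shuffles -/

section ShuffleSums

variable {K H Z : Type*} [Field K] [AddCommGroup H] [Module K H] [AddCommGroup Z] [Module K Z]
  {ℋ : ℤ → Submodule K H}

theorem prod_ite_zpow {p : ℕ} (y : Fin p → Homog ℋ) (k : ℕ) (e : ℤ) :
    (∏ i : Fin p, if (i : ℕ) < k then (-1 : K) ^ (e * (y i).1) else 1) =
      (-1 : K) ^ (e * deg ((List.ofFn y).take k)) := by
  induction p generalizing k with
  | zero => simp
  | succ p ih =>
    cases k with
    | zero => simp
    | succ k =>
      have := ih (fun i => y i.succ) k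
      simp only [Fin.prod_univ_succ, List.ofFn_succ, List.take_succ_cons, deg_cons, mul_add,
        Fin.val_succ, add_lt_add_iff_right, this]
      rw [zpow_add₀ (neg_ne_zero.2 one_ne_zero)]
      simp

/-- The Koszul sign of a permutation of homogeneous elements. -/
def listSign {p : ℕ} (σ : Equiv.Perm (Fin p)) (x : Fin p → Homog ℋ) : K :=
  koszulSign K σ fun i => (x i).1

/-- The first element is passed by exactly the k elements placed before it; all other inversions are
those of σ. -/
theorem listSign_insPerm {p : ℕ} (k : Fin (p + 1)) (σ : Equiv.Perm (Fin p))
    (x : Fin (p + 1) → Homog ℋ) :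
    listSign (insPerm k σ) x =
      (-1 : K) ^ ((x 0).1 * deg ((List.ofFn fun i => x (σ i).succ).take k)) *
        listSign σ fun i => x i.succ := by
  simp only [listSign, koszulSign]
  rw [Fin.prod_univ_succAbove _ k, Finset.prod_eq_one (fun j _ => by simp), one_mul]
  rw [← prod_ite_zpow (fun i => x (σ i).succ) k, ← Finset.prod_mul_distrib]
  refine Finset.prod_congr rfl fun i _ => ?_
  rw [Fin.prod_univ_succAbove _ k]
  congr 1
  · have h : k.succAbove i < k ↔ (i : ℕ) < k := by
      rw [Fin.lt_def, val_succAbove]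
      split_ifs <;> omega
    simp [h, mul_comm]
  · refine Finset.prod_congr rfl fun j _ => ?_
    simp [(Fin.strictMono_succAbove k).lt_iff_lt]

/-- The sum over all ways to split a list into two sublists, with Koszul signs. -/
def unshuffle (K : Type*) {H Z : Type*} [Field K] [AddCommGroup H] [Module K H] [AddCommGroup Z]
    [Module K Z] {ℋ : ℤ → Submodule K H} :
    (List (Homog ℋ) → List (Homog ℋ) → Z) → List (Homog ℋ) → Z
  | Φ, [] => Φ [] []
  | Φ, a :: l => unshuffle K (fun A B => Φ (a :: A) B) l +
      unshuffle K (fun A B => (-1 : K) ^ (a.1 * deg A) • Φ A (a :: B)) l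

/-- The sum over all ways to split a list into two sublists, the second of which is nonempty and
has its first element at an arbitrary place, with Koszul signs. -/
def unshuffle₃ (K : Type*) {H Z : Type*} [Field K] [AddCommGroup H] [Module K H] [AddCommGroup Z]
    [Module K Z] {ℋ : ℤ → Submodule K H} :
    (List (Homog ℋ) → List (Homog ℋ) → Z) → List (Homog ℋ) → Z
  | _, [] => 0
  | Φ, a :: l => unshuffle₃ K (fun A B => Φ (a :: A) B) l +
      unshuffle K (fun A B => (-1 : K) ^ (a.1 * deg A) • Φ A (a :: B)) l +
      unshuffle₃ K (fun A B => (-1 : K) ^ (a.1 * (deg A + deg (B.take 1))) •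
        Φ A (B.take 1 ++ a :: B.drop 1)) l

theorem unshuffle_smul (c : K) (Φ : List (Homog ℋ) → List (Homog ℋ) → Z) (l : List (Homog ℋ)) :
    unshuffle K (fun A B => c • Φ A B) l = c • unshuffle K Φ l := by
  induction l generalizing Φ with
  | nil => rfl
  | cons a l ih =>
    simp only [unshuffle, smul_add, ih (fun A B => Φ (a :: A) B),
      ← ih (fun A B => _ • Φ A (a :: B)),
      smul_comm c]

theorem unshuffle₃_smul (c : K) (Φ : List (Homog ℋ) → List (Homog ℋ) → Z) (l : List (Homog ℋ)) :
    unshuffle₃ K (fun A B => c • Φ A B) l = c • unshuffle₃ K Φ l := by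
  induction l generalizing Φ with
  | nil => simp [unshuffle₃]
  | cons a l ih =>
    simp only [unshuffle₃, smul_add, ih (fun A B => Φ (a :: A) B), ← unshuffle_smul,
      ← ih (fun A B => _ • Φ A (B.take 1 ++ a :: B.drop 1)), smul_comm c]

theorem sum_shuffles_succ {p : ℕ} (a : ℕ) (F : Equiv.Perm (Fin (p + 1)) → Z) :
    ∑ σ ∈ shuffles (p + 1) a, F σ =
      (if 0 < a then ∑ σ ∈ shuffles p (a - 1), F (insPerm 0 σ) else 0) +
        ∑ k : Fin (p + 1), if (k : ℕ) = a then ∑ σ ∈ shuffles p a, F (insPerm k σ) else 0 := by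
  have h1 : ∑ σ ∈ shuffles (p + 1) a, F σ = ∑ σ, if σ ∈ shuffles (p + 1) a then F σ else 0 := by
    simp
  have h2 : (if 0 < a then ∑ σ ∈ shuffles p (a - 1), F (insPerm 0 σ) else 0) =
      ∑ k : Fin (p + 1), if k = 0 ∧ 0 < a then ∑ σ ∈ shuffles p (a - 1), F (insPerm k σ)
        else 0 := by
    simp [ite_and]
  rw [h1, sum_perm_succ, h2, ← Finset.sum_add_distrib]
  refine Finset.sum_congr rfl fun k _ => ?_
  simp only [insPerm_mem_shuffles]
  by_cases hP : k = 0 ∧ 0 < a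
  · have hQ : (k : ℕ) ≠ a := by rw [hP.1]; exact hP.2.ne
    simp [hP, hQ, hP.2.ne]
  · have hP' : ¬(k = 0 ∧ 0 < a ∧ (True : Prop)) := by simpa using hP
    by_cases hQ : (k : ℕ) = a
    · simp [hP, hQ, ← and_assoc]
    · simp [hP, hQ, ← and_assoc]

theorem sum_shuffles₃_succ {p : ℕ} (a : ℕ) (F : Equiv.Perm (Fin (p + 1)) → Z) :
    ∑ σ ∈ shuffles₃ (p + 1) a, F σ =
      (if 0 < a then ∑ σ ∈ shuffles₃ p (a - 1), F (insPerm 0 σ) else 0) +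
        (∑ k : Fin (p + 1), if (k : ℕ) = a then ∑ σ ∈ shuffles p a, F (insPerm k σ) else 0) +
        ∑ k : Fin (p + 1), if (k : ℕ) = a + 1 then ∑ σ ∈ shuffles₃ p a, F (insPerm k σ)
          else 0 := by
  have h1 : ∑ σ ∈ shuffles₃ (p + 1) a, F σ =
      ∑ σ, if σ ∈ shuffles₃ (p + 1) a then F σ else 0 := by
    simp
  have h2 : (if 0 < a then ∑ σ ∈ shuffles₃ p (a - 1), F (insPerm 0 σ) else 0) =
      ∑ k : Fin (p + 1), if k = 0 ∧ 0 < a then ∑ σ ∈ shuffles₃ p (a - 1), F (insPerm k σ)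
        else 0 := by
    simp [ite_and]
  rw [h1, sum_perm_succ, h2, ← Finset.sum_add_distrib, ← Finset.sum_add_distrib]
  refine Finset.sum_congr rfl fun k _ => ?_
  simp only [insPerm_mem_shuffles₃]
  by_cases hP : k = 0 ∧ 0 < a
  · simp [hP, hP.2.ne]
  · by_cases hQ : (k : ℕ) = a
    · simp [hP, hQ, ← and_assoc]
    · by_cases hR : (k : ℕ) = a + 1
      · simp [hP, hQ, hR, ← and_assoc]
      · simp [hP, hQ, hR, ← and_assoc]

/-- Splitting shuffles by the block of the first argument reproduces the recursion of `unshuffle`,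
with the Koszul sign appearing when that argument joins the second block. -/
theorem sum_shuffles {p : ℕ} (x : Fin p → Homog ℋ) (Φ : List (Homog ℋ) → List (Homog ℋ) → Z) :
    ∑ l : Fin (p + 1), ∑ σ ∈ shuffles p l, (listSign σ x : K) •
      Φ ((List.ofFn fun i => x (σ i)).take l) ((List.ofFn fun i => x (σ i)).drop l) =
    unshuffle K Φ (List.ofFn x) := by
  induction p generalizing Φ with
  | zero =>
    have : shuffles 0 0 = {1} := by decide
    simp [unshuffle, listSign, koszulSign, this]
  | succ p ih =>
    simp only [sum_shuffles_succ]
    rw [Finset.sum_add_distrib, List.ofFn_succ, unshuffle, ← ih, ← ih]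
    congr 1
    · rw [Fin.sum_univ_succ]
      simp [listSign_insPerm, ofFn_insPerm]
    · rw [Finset.sum_comm]
      refine Finset.sum_congr rfl fun k _ => ?_
      rw [Finset.sum_eq_single k.castSucc (fun l _ hl => if_neg fun h => hl (Fin.ext h.symm))
        (by simp), if_pos (by simp)]
      refine Finset.sum_congr rfl fun σ _ => ?_
      have hlen : ((List.ofFn fun i => x (σ i).succ).take k).length = k := by
        simp; omega
      rw [listSign_insPerm, ofFn_insPerm, Fin.val_castSucc, List.take_left' hlen,
        List.drop_left' hlen, mul_comm, mul_smul]

theorem sum_shuffles₃ {p : ℕ} (x : Fin p → Homog ℋ)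
    (Φ : List (Homog ℋ) → List (Homog ℋ) → Z) :
    ∑ l : Fin p, ∑ σ ∈ shuffles₃ p l, (listSign σ x : K) •
      Φ ((List.ofFn fun i => x (σ i)).take l) ((List.ofFn fun i => x (σ i)).drop l) =
    unshuffle₃ K Φ (List.ofFn x) := by
  induction p generalizing Φ with
  | zero => simp [unshuffle₃]
  | succ p ih =>
    simp only [sum_shuffles₃_succ]
    rw [Finset.sum_add_distrib, Finset.sum_add_distrib, List.ofFn_succ, unshuffle₃, ← ih, ← ih,
      ← sum_shuffles]
    congr 1
    · congr 1
      · rw [Fin.sum_univ_succ]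
        simp [listSign_insPerm, ofFn_insPerm]
      · rw [Finset.sum_comm]
        refine Finset.sum_congr rfl fun k _ => ?_
        rw [Finset.sum_eq_single k (fun l _ hl => if_neg fun h => hl (Fin.ext h.symm))
          (by simp), if_pos rfl]
        refine Finset.sum_congr rfl fun σ _ => ?_
        have hlen : ((List.ofFn fun i => x (σ i).succ).take k).length = k := by
          simp; omega
        rw [listSign_insPerm, ofFn_insPerm, List.take_left' hlen,
          List.drop_left' hlen, mul_comm, mul_smul]
    -- The first argument opens the last block, at position l + 1. Position 0 is thus impossible,
    -- and position k + 1 forces l = k.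
    · rw [Finset.sum_comm, Fin.sum_univ_succ]
      rw [Finset.sum_eq_zero (fun l _ => if_neg (by simp)), zero_add]
      refine Finset.sum_congr rfl fun k _ => ?_
      rw [Finset.sum_eq_single k.castSucc
        (fun l _ hl => if_neg fun h => hl (Fin.ext (by simpa using h.symm))) (by simp),
        if_pos (by simp)]
      refine Finset.sum_congr rfl fun σ _ => ?_
      rw [listSign_insPerm, ofFn_insPerm, Fin.val_castSucc, Fin.val_succ]
      generalize hL : (List.ofFn fun i => x (σ i).succ) = L
      have hk : (k : ℕ) + 1 ≤ L.length := by rw [← hL]; simp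
      have hlen : (L.take k).length = k := by rw [List.length_take]; omega
      have hT : L.take (k + 1) = L.take k ++ (L.drop k).take 1 := by rw [List.take_add]
      rw [hT, deg_append, List.append_assoc, List.take_left' hlen, List.drop_left' hlen,
        mul_comm, mul_smul, List.drop_drop]

end ShuffleSums

/-! ### Sums over pairs of arguments -/

section PairSums

variable {K H Z : Type*} [Field K] [AddCommGroup H] [Module K H] [AddCommGroup Z] [Module K Z]
  {ℋ : ℤ → Submodule K H}

/-- The sum over all elements of a list, moved to the front, with Koszul signs. -/
def pickOne (K : Type*) {H Z : Type*} [Field K] [AddCommGroup H] [Module K H] [AddCommGroup Z]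
    [Module K Z] {ℋ : ℤ → Submodule K H} :
    (Homog ℋ → List (Homog ℋ) → Z) → List (Homog ℋ) → Z
  | _, [] => 0
  | Φ, a :: l => Φ a l + pickOne K (fun c L => (-1 : K) ^ (a.1 * c.1) • Φ c (a :: L)) l

/-- The sum over all pairs of elements of a list, moved to the front, with Koszul signs. -/
def pickTwo (K : Type*) {H Z : Type*} [Field K] [AddCommGroup H] [Module K H] [AddCommGroup Z]
    [Module K Z] {ℋ : ℤ → Submodule K H} :
    (Homog ℋ → Homog ℋ → List (Homog ℋ) → Z) → List (Homog ℋ) → Z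
  | _, [] => 0
  | Φ, a :: l => pickOne K (Φ a) l +
      pickTwo K (fun c e L => (-1 : K) ^ (a.1 * (c.1 + e.1)) • Φ c e (a :: L)) l

theorem pickOne_smul (c : K) (Φ : Homog ℋ → List (Homog ℋ) → Z) (l : List (Homog ℋ)) :
    pickOne K (fun x L => c • Φ x L) l = c • pickOne K Φ l := by
  induction l generalizing Φ with
  | nil => simp [pickOne]
  | cons a l ih =>
    simp only [pickOne, smul_add, ← ih (fun x L => _ • Φ x (a :: L)), smul_comm c]

theorem pickTwo_smul (c : K) (Φ : Homog ℋ → Homog ℋ → List (Homog ℋ) → Z)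
    (l : List (Homog ℋ)) :
    pickTwo K (fun x y L => c • Φ x y L) l = c • pickTwo K Φ l := by
  induction l generalizing Φ with
  | nil => simp [pickTwo]
  | cons a l ih =>
    simp only [pickTwo, smul_add, ← ih (fun x y L => _ • Φ x y (a :: L)), smul_comm c,
      ← pickOne_smul]

theorem sum_Iio_zero {q : ℕ} (d : Fin (q + 1) → ℤ) : ∑ t ∈ Iio (0 : Fin (q + 1)), d t = 0 :=
  Finset.sum_eq_zero fun t ht => absurd (Finset.mem_Iio.1 ht) (Fin.not_lt_zero t)

theorem sum_Iio_succ {q : ℕ} (d : Fin (q + 1) → ℤ) (j : Fin q) :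
    ∑ t ∈ Iio j.succ, d t = d 0 + ∑ t ∈ Iio j, d t.succ := by
  have : Iio j.succ = insert 0 ((Iio j).map (Fin.succEmb q)) := by
    ext t
    refine Fin.cases ?_ (fun t => ?_) t <;> simp
  rw [this, Finset.sum_insert (by simp), Finset.sum_map]
  rfl

theorem sum_pickOne {q : ℕ} (x : Fin (q + 1) → Homog ℋ) (Φ : Homog ℋ → List (Homog ℋ) → Z) :
    ∑ j, (-1 : K) ^ ((x j).1 * ∑ t ∈ Iio j, (x t).1) •
      Φ (x j) (List.ofFn fun t => x (j.succAbove t)) = pickOne K Φ (List.ofFn x) := by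
  induction q generalizing Φ with
  | zero =>
    simp [pickOne, sum_Iio_zero]
  | succ q ih =>
    rw [Fin.sum_univ_succ, List.ofFn_succ (f := x), pickOne, ← ih]
    congr 1
    · simp [sum_Iio_zero]
    · refine Finset.sum_congr rfl fun j _ => ?_
      rw [sum_Iio_succ (fun t => (x t).1), List.ofFn_succ, Fin.succ_succAbove_zero, smul_smul,
        ← zpow_add₀ (neg_ne_zero.2 one_ne_zero)]
      simp only [Fin.succ_succAbove_succ]
      congr 2
      ring

/-- For i = 0 the sign for v_i v_j cancels the contribution of v_0 to the sum of degrees before j,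
leaving the sign of `pickOne` on the tail. -/
theorem sum_pickTwo_zero {q : ℕ} (x : Fin (q + 2) → Homog ℋ)
    (Φ : Homog ℋ → List (Homog ℋ) → Z) :
    (∑ j : Fin (q + 2), if (0 : Fin (q + 1)).castSucc < j then
      (-1 : K) ^ ((x (0 : Fin (q + 1)).castSucc).1 *
        (∑ t ∈ Iio (0 : Fin (q + 1)).castSucc, (x t).1) +
        (x j).1 * (∑ t ∈ Iio j, (x t).1) + (x (0 : Fin (q + 1)).castSucc).1 * (x j).1) •
      Φ (x j) (List.ofFn fun t => x (j.succAbove ((0 : Fin (q + 1)).succAbove t))) else 0) =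
      pickOne K Φ (List.ofFn fun i => x i.succ) := by
  rw [← sum_pickOne, Fin.sum_univ_succ, if_neg (by simp), zero_add]
  refine Finset.sum_congr rfl fun j _ => ?_
  rw [if_pos (by simp [Fin.lt_def]), sum_Iio_succ (fun t => (x t).1)]
  simp only [Fin.castSucc_zero, Fin.zero_succAbove, Fin.succ_succAbove_succ, sum_Iio_zero]
  congr 1
  simp only [negOne_zpow]
  cases h1 : odd (x 0).1 <;> cases h2 : odd (x j.succ).1 <;> simp [h1, h2]

theorem sum_pickTwo {q : ℕ} (x : Fin (q + 2) → Homog ℋ)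
    (Φ : Homog ℋ → Homog ℋ → List (Homog ℋ) → Z) :
    (∑ i : Fin (q + 1), ∑ j : Fin (q + 2), if i.castSucc < j then
      (-1 : K) ^ ((x i.castSucc).1 * (∑ t ∈ Iio i.castSucc, (x t).1) +
        (x j).1 * (∑ t ∈ Iio j, (x t).1) + (x i.castSucc).1 * (x j).1) •
      Φ (x i.castSucc) (x j) (List.ofFn fun t => x (j.succAbove (i.succAbove t))) else 0) =
      pickTwo K Φ (List.ofFn x) := by
  induction q generalizing Φ with
  | zero =>
    rw [Fin.sum_univ_one, List.ofFn_succ (f := x), pickTwo, ← sum_pickTwo_zero x (Φ (x 0))]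
    simp [pickTwo, pickOne]
  | succ q ih =>
    rw [Fin.sum_univ_succ, List.ofFn_succ (f := x), pickTwo, ← ih]
    congr 1
    · exact sum_pickTwo_zero x _
    · refine Finset.sum_congr rfl fun i _ => ?_
      rw [Fin.sum_univ_succ, if_neg (by simp), zero_add]
      refine Finset.sum_congr rfl fun j _ => ?_
      rw [← Fin.succ_castSucc]
      simp only [Fin.succ_lt_succ_iff]
      refine if_congr Iff.rfl ?_ rfl
      rw [sum_Iio_succ (fun t => (x t).1), sum_Iio_succ (fun t => (x t).1), List.ofFn_succ,
        Fin.succ_succAbove_zero, Fin.succ_succAbove_zero, smul_smul,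
        ← zpow_add₀ (neg_ne_zero.2 one_ne_zero)]
      simp only [Fin.succ_succAbove_succ]
      congr 2
      ring

end PairSums

/-! ### Products and insertions as sums over unshuffles -/

section Unshuffles

variable {K H W U Z : Type*} [Field K] [AddCommGroup H] [Module K H] [AddCommGroup W] [Module K W]
  [AddCommGroup U] [Module K U] [AddCommGroup Z] [Module K Z]
  {ℋ : ℤ → Submodule K H}

theorem zpow_smul_smul (m n : ℤ) (w : W) :
    (-1 : K) ^ m • (-1 : K) ^ n • w = (-1 : K) ^ (m + n) • w := by
  rw [smul_smul, zpow_add₀ (neg_ne_zero.2 one_ne_zero)]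

/-- Here (-1)^(n deg A) is the sign of moving g past the arguments of f; its growth by one argument
is the sign in the recursion of `prod`. -/
theorem unshuffle_eq_prod (b : ℤ → ℤ → W →ₗ[K] U →ₗ[K] Z) (m n : ℤ) (f : List (Homog ℋ) → W)
    (g : List (Homog ℋ) → U) (l : List (Homog ℋ)) :
    unshuffle K (fun A B => (-1 : K) ^ (n * deg A) • b (m + deg A) (n + deg B) (f A) (g B)) l =
      prod b m n f g l := by
  induction l generalizing m n f g with
  | nil => simp [unshuffle, prod]
  | cons a l ih =>
    simp only [unshuffle, prod, ← ih, ← unshuffle_smul]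
    congr 2 <;> funext A B
    · simp only [deg_cons, zpow_smul_smul, ← add_assoc, mul_add, fixFirst]
    · simp only [deg_cons, zpow_smul_smul, ← add_assoc, add_mul, fixFirst]
      rw [add_comm (a.1 * deg A)]

/-- The identity cochain has already received its only argument, so all the others must go to g. -/
theorem prod_fixFirst_idCochain (a : W →ₗ[K] Module.End K H) (n j : ℤ) (g : List (Homog ℋ) → W)
    (x : Homog ℋ) (l : List (Homog ℋ)) :
    prod (fun _ _ => a) n j g (fixFirst x (idCochain ℋ)) l =
      (-1 : K) ^ (j * deg l) • a (g l) x.2 := by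
  induction l generalizing n g with
  | nil => simp [prod, fixFirst, idCochain]
  | cons c l ih =>
    simp only [prod, fixFirst_fixFirst_idCochain, prod_zero_right, ih, deg_cons, zpow_smul_smul,
      mul_add, Pi.zero_apply, add_zero]
    rfl

theorem unshuffle₃_congr {Φ Φ' : List (Homog ℋ) → List (Homog ℋ) → Z}
    (h : ∀ A v C, Φ A (v :: C) = Φ' A (v :: C)) (l : List (Homog ℋ)) :
    unshuffle₃ K Φ l = unshuffle₃ K Φ' l := by
  induction l generalizing Φ Φ' with
  | nil => rfl
  | cons a l ih =>
    simp only [unshuffle₃, h]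
    have h1 := ih (Φ := fun A B => Φ (a :: A) B) (Φ' := fun A B => Φ' (a :: A) B)
      fun A v C => h (a :: A) v C
    have h2 := ih (Φ := fun A B => (-1 : K) ^ (a.1 * (deg A + deg (B.take 1))) •
        Φ A (B.take 1 ++ a :: B.drop 1))
      (Φ' := fun A B => (-1 : K) ^ (a.1 * (deg A + deg (B.take 1))) •
        Φ' A (B.take 1 ++ a :: B.drop 1)) fun A v C => by simp [h]
    rw [h1, h2]

variable [DirectSum.Decomposition ℋ]

theorem IsSymMultilinear.swap_homogPart {f : List (Homog ℋ) → W} (hf : IsSymMultilinear f) (n : ℤ)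
    (v : H) (a : Homog ℋ) (l : List (Homog ℋ)) :
    f (homogPart ℋ n v :: a :: l) = (-1 : K) ^ (n * a.1) • f (a :: homogPart ℋ n v :: l) :=
  hf.swap [] l _ _

theorem IsSymMultilinear.apply_homogPart_zero {f : List (Homog ℋ) → W} (hf : IsSymMultilinear f)
    (n : ℤ) (l : List (Homog ℋ)) : f (homogPart ℋ n 0 :: l) = 0 := by
  simpa using hf.apply_homogPart_smul n 0 0 l

theorem unshuffle_eq_ins {f : List (Homog ℋ) → W} (hf : IsSymMultilinear f) (n : ℤ)
    (r : List (Homog ℋ) → H) (l : List (Homog ℋ)) :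
    unshuffle K (fun A B => f (homogPart ℋ (n + deg A) (r A) :: B)) l = ins n r f l := by
  induction l generalizing n r f with
  | nil => simp [unshuffle, ins]
  | cons a l ih =>
    simp only [unshuffle, ins, ← ih hf, ← ih (hf.fixFirst a), ← unshuffle_smul]
    congr 2 <;> funext A B
    · simp only [deg_cons, ← add_assoc, fixFirst]
    · rw [hf.swap_homogPart, zpow_smul_smul, fixFirst]
      simp only [negOne_zpow]
      cases ha : odd a.1 <;> cases hn : odd n <;> simp [ha, hn]

/-- The value of `f` on `a(g(A)) v, C` for `v :: C = B`. -/
def insertValue (a : W →ₗ[K] Module.End K H) (n : ℤ) (g : List (Homog ℋ) → W)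
    (f : List (Homog ℋ) → Z) (A : List (Homog ℋ)) : List (Homog ℋ) → Z
  | [] => 0
  | v :: C => f (homogPart ℋ (n + 1 + deg A + v.1) (a (g A) v.2) :: C)

/-- A new argument x goes to g, or is the vector acted upon, or goes to f: the Leibniz rule for
X_g·f has these three summands, and so has `unshuffle₃`. -/
theorem unshuffle₃_eq_ins (a : W →ₗ[K] Module.End K H) {f : List (Homog ℋ) → Z}
    (hf : IsSymMultilinear f) (n : ℤ) (g : List (Homog ℋ) → W) (l : List (Homog ℋ)) :
    unshuffle₃ K (insertValue a n g f) l = ins (n + 1) (vectorField a n g) f l := by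
  induction l generalizing n g f with
  | nil =>
    simp [unshuffle₃, ins, vectorField, prod, idCochain, hf.apply_homogPart_zero]
  | cons x l ih =>
    have h : fixFirst x (vectorField a n g) = vectorField a (n + x.1) (fixFirst x g) +
        prod (fun _ _ => a) n x.1 g (fixFirst x (idCochain ℋ)) := by
      simp [vectorField, fixFirst_prod]
    simp only [unshuffle₃, ins, h, hf.ins_add_left, Pi.add_apply]
    rw [← ih (hf.fixFirst x), ← unshuffle₃_smul, add_right_comm n 1 x.1, ← ih hf,
      ← unshuffle_eq_ins hf]
    refine congrArg₂ (· + ·) (congrArg₂ (· + ·) ?_ ?_) ?_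
    · refine unshuffle₃_congr (fun A v C => ?_) l
      simp only [insertValue, deg_cons, fixFirst]
      rw [show n + 1 + (x.1 + deg A) + v.1 = n + x.1 + 1 + deg A + v.1 by ring]
    · congr 1
      funext A B
      rw [prod_fixFirst_idCochain, hf.apply_homogPart_smul, insertValue]
      rw [show n + 1 + deg A + x.1 = n + x.1 + 1 + deg A by ring]
    · refine unshuffle₃_congr (fun A v C => ?_) l
      simp only [insertValue, List.take_succ_cons, List.take_zero, List.drop_succ_cons,
        List.drop_zero, List.cons_append, List.nil_append, deg_cons, deg_nil, fixFirst]
      rw [hf.swap_homogPart, zpow_smul_smul]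
      simp only [negOne_zpow]
      cases hx : odd x.1 <;> cases hn : odd n <;> cases hv : odd v.1 <;> simp [hx, hn, hv]

theorem ins_const {f : List (Homog ℋ) → W} (hf : IsSymMultilinear f) (n : ℤ)
    {r : List (Homog ℋ) → H} (hr : ∀ a, fixFirst a r = 0) (l : List (Homog ℋ)) :
    ins n r f l = f (homogPart ℋ n (r []) :: l) := by
  induction l generalizing f with
  | nil => rfl
  | cons a l ih =>
    rw [ins, hr, hf.ins_zero_left, ih (hf.fixFirst a), hf.swap_homogPart]
    simp [fixFirst]

theorem pickOne_eq_ins {f : List (Homog ℋ) → W} (hf : IsSymMultilinear f) (n : ℤ)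
    {r : List (Homog ℋ) → H} (h0 : r [] = 0) (hr : ∀ a b, fixFirst b (fixFirst a r) = 0)
    (l : List (Homog ℋ)) :
    pickOne K (fun y L => f (homogPart ℋ (n + y.1) (r [y]) :: L)) l = ins n r f l := by
  induction l generalizing f with
  | nil => simp [pickOne, ins, h0, hf.apply_homogPart_zero]
  | cons a l ih =>
    rw [ins, pickOne, ins_const hf _ (hr a), ← ih (hf.fixFirst a), ← pickOne_smul]
    congr 2
    funext c L
    rw [hf.swap_homogPart, zpow_smul_smul, fixFirst]
    simp only [negOne_zpow]
    cases ha : odd a.1 <;> cases hn : odd n <;> cases hc : odd c.1 <;> simp [ha, hn, hc]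

/-- The derivative of q at the head argument is concentrated on one remaining argument, which
accounts for the pairs containing the head; induction handles the others. -/
theorem pickTwo_eq_ins [CharZero K] (𝔥 : SymGradedLie K ℋ) {f : List (Homog ℋ) → W}
    (hf : IsSymMultilinear f) (l : List (Homog ℋ)) :
    pickTwo K (fun x y L => f (homogPart ℋ (1 + x.1 + y.1) (𝔥.bracket x.2 y.2) :: L)) l =
      ins 1 (bracketCochain 𝔥) f l := by
  induction l generalizing f with
  | nil => simp [pickTwo, ins, bracketCochain_nil, hf.apply_homogPart_zero]
  | cons a l ih =>
    rw [ins, pickTwo, ← ih (hf.fixFirst a), ← pickTwo_smul,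
      ← pickOne_eq_ins hf _ (r := fixFirst a (bracketCochain 𝔥))
        (fixFirst_bracketCochain 𝔥 a a []).1
        fun b c => funext fun l => (fixFirst_bracketCochain 𝔥 a b (c :: l)).2 (by simp)]
    congr 2
    · funext y L
      rw [fixFirst, bracketCochain_pair]
    · funext c e L
      rw [hf.swap_homogPart, zpow_smul_smul, fixFirst]
      simp only [negOne_zpow]
      cases ha : odd a.1 <;> cases he : odd e.1 <;> cases hc : odd c.1 <;> simp [ha, he, hc]

end Unshuffles

/-! ### Families of multilinear maps as functions of lists -/

section Families

variable {K H W : Type*} [Field K] [AddCommGroup H] [Module K H] [AddCommGroup W] [Module K W]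
  {ℋ : ℤ → Submodule K H} {𝒲 : ℤ → Submodule K W}

/-- The function of lists of homogeneous elements which is given by a family of multilinear
maps. -/
def onLists (ℋ : ℤ → Submodule K H) (F : Family K H W) : List (Homog ℋ) → W := fun l =>
  F l.length fun i => (l.get i).2

theorem onLists_add (F F' : Family K H W) : onLists ℋ (F + F') = onLists ℋ F + onLists ℋ F' := rfl

theorem onLists_smul (c : K) (F : Family K H W) : onLists ℋ (c • F) = c • onLists ℋ F := rfl

theorem onLists_ofFn (F : Family K H W) {p : ℕ} (x : Fin p → Homog ℋ) :
    onLists ℋ F (List.ofFn x) = F p fun i => (x i).2 := by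
  have key : ∀ (k : ℕ) (h : k = p) (v : Fin k → H), (∀ i, v i = (x (Fin.cast h i)).2) →
      F k v = F p fun i => (x i).2 := by
    rintro k rfl v hv
    exact congrArg _ (funext hv)
  exact key _ (List.length_ofFn) _ fun i => by rw [List.get_ofFn]

theorem onLists_cons_ofFn (F : Family K H W) {p : ℕ} (u : Homog ℋ) (x : Fin p → Homog ℋ) :
    onLists ℋ F (u :: List.ofFn x) = F (p + 1) (Fin.cons (u.2 : H) fun i => ((x i).2 : H)) := by
  have h : u :: List.ofFn x = List.ofFn (Fin.cons u x : Fin (p + 1) → Homog ℋ) := by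
    simp [List.ofFn_succ]
  rw [h, onLists_ofFn]
  congr 1
  funext i
  refine Fin.cases rfl (fun i => rfl) i

/-- Fix the first argument of all members of a family. -/
def curryFamily (v : H) (F : Family K H W) : Family K H W := fun k => (F (k + 1)).curryLeft v

theorem fixFirst_onLists (a : Homog ℋ) (F : Family K H W) :
    fixFirst a (onLists ℋ F) = onLists ℋ (curryFamily a.2 F) := by
  funext l
  change F (l.length + 1) _ = F (l.length + 1) (Fin.cons _ _)
  congr 1
  funext i
  refine Fin.cases rfl (fun i => rfl) i

theorem deg_ofFn {p : ℕ} (x : Fin p → Homog ℋ) : deg (List.ofFn x) = ∑ i, (x i).1 := by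
  simp [deg, List.map_ofFn, List.sum_ofFn]

theorem listSign_one {p : ℕ} (x : Fin p → Homog ℋ) : (listSign 1 x : K) = 1 := by
  rw [listSign, koszulSign]
  refine Finset.prod_eq_one fun i _ => Finset.prod_eq_one fun j _ => if_neg ?_
  rintro ⟨h, h'⟩
  exact lt_asymm h h'

/-- Graded symmetry with respect to all permutations. -/
def IsPermSymm (f : List (Homog ℋ) → W) : Prop :=
  ∀ (p : ℕ) (x : Fin p → Homog ℋ) (σ : Equiv.Perm (Fin p)),
    f (List.ofFn x) = (listSign σ x : K) • f (List.ofFn fun i => x (σ i))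

theorem IsPermSymm.fixFirst {f : List (Homog ℋ) → W} (hf : IsPermSymm f) (a : Homog ℋ) :
    IsPermSymm (fixFirst a f) := by
  intro p x σ
  have := hf (p + 1) (Fin.cons a x) (insPerm 0 σ)
  rw [ofFn_insPerm, listSign_insPerm, List.ofFn_succ] at this
  simpa [HomotopyLie.fixFirst] using this

theorem IsPermSymm.swap {f : List (Homog ℋ) → W} (hf : IsPermSymm f) (l l' : List (Homog ℋ))
    (a b : Homog ℋ) :
    f (l ++ a :: b :: l') = (-1 : K) ^ (a.1 * b.1) • f (l ++ b :: a :: l') := by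
  induction l generalizing f with
  | nil =>
    -- `insPerm 1 1` is the transposition of the first two places.
    have := hf (l'.length + 2) (Fin.cons a (Fin.cons b l'.get)) (insPerm 1 1)
    rw [ofFn_insPerm, listSign_insPerm, List.ofFn_succ] at this
    simpa [List.ofFn_succ, listSign_one] using this
  | cons c l ih => exact ih (hf.fixFirst c)

theorem IsSymMultilinear.move {f : List (Homog ℋ) → W} (hf : IsSymMultilinear f)
    (A B : List (Homog ℋ)) (a : Homog ℋ) :
    f (A ++ a :: B) = (-1 : K) ^ (a.1 * deg A) • f (a :: (A ++ B)) := by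
  induction A generalizing f with
  | nil => simp
  | cons c A ih =>
    have h1 := ih (hf.fixFirst c)
    have h2 := hf.swap [] (A ++ B) c a
    simp only [HomotopyLie.fixFirst, List.nil_append] at h1 h2
    rw [List.cons_append, h1, h2, zpow_smul_smul, deg_cons]
    congr 2
    ring

/-- Write the permutation as `insPerm k σ`: induction permutes the tail by σ, and adjacent swaps
then carry the head to position k. -/
theorem IsSymMultilinear.isPermSymm {f : List (Homog ℋ) → W} (hf : IsSymMultilinear f) :
    IsPermSymm f := by
  intro p x σ
  induction p generalizing f with
  | zero =>
    obtain rfl := Subsingleton.elim 1 σ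
    rw [listSign_one, one_smul]; rfl
  | succ p ih =>
    obtain ⟨⟨k, σ⟩, rfl⟩ := insPerm_bijective.2 σ
    have h := ih (hf.fixFirst (x 0)) (fun i => x i.succ) σ
    simp only [HomotopyLie.fixFirst] at h
    rw [List.ofFn_succ, h]
    simp only [ofFn_insPerm, listSign_insPerm]
    rw [hf.move, List.take_append_drop, mul_comm, mul_smul, zpow_smul_smul]
    simp only [negOne_zpow]
    cases h : odd ((x 0).1 * deg ((List.ofFn fun i => x (σ i).succ).take k)) <;> simp [h]

theorem onLists_add_smul (F : Family K H W) (l l' : List (Homog ℋ)) (i : ℤ) :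
    (∀ x y : ℋ i, onLists ℋ F (l ++ ⟨i, x + y⟩ :: l') =
      onLists ℋ F (l ++ ⟨i, x⟩ :: l') + onLists ℋ F (l ++ ⟨i, y⟩ :: l')) ∧
    ∀ (c : K) (x : ℋ i), onLists ℋ F (l ++ ⟨i, c • x⟩ :: l') =
      c • onLists ℋ F (l ++ ⟨i, x⟩ :: l') := by
  induction l generalizing F with
  | nil =>
    have h : ∀ z : ℋ i, onLists ℋ F (⟨i, z⟩ :: l') = (F (l'.length + 1)).curryLeft (z : H)
        fun i => (l'.get i).2 := fun z => congrFun (fixFirst_onLists ⟨i, z⟩ F) l'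
    refine ⟨fun x y => ?_, fun c x => ?_⟩
    · simp only [List.nil_append, h, Submodule.coe_add, map_add, add_apply]
    · simp only [List.nil_append, h, Submodule.coe_smul, map_smul, smul_apply]
  | cons a l ih =>
    have h : ∀ L, onLists ℋ F (a :: L) = onLists ℋ (curryFamily a.2 F) L :=
      congrFun (fixFirst_onLists a F)
    simpa only [List.cons_append, h] using ih (curryFamily a.2 F)

theorem mem_symHom_iff {F : Family K H W} {n : ℤ} :
    F ∈ symHom ℋ 𝒲 n ↔ HasDeg 𝒲 n (onLists ℋ F) ∧ IsSymMultilinear (onLists ℋ F) := by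
  constructor
  · intro hF
    refine ⟨fun l => ?_, ?_⟩
    · have := (hF l.length (fun i => (l.get i).1) (fun i => (l.get i).2) fun i => (l.get i).2.2).1
      rwa [← deg_ofFn, List.ofFn_get] at this
    · have hs : IsPermSymm (onLists ℋ F) := fun p x σ => by
        rw [onLists_ofFn, onLists_ofFn]
        exact (hF p (fun i => (x i).1) (fun i => (x i).2) fun i => (x i).2.2).2 σ
      exact ⟨fun l l' i => (onLists_add_smul F l l' i).1,
        fun l l' i => (onLists_add_smul F l l' i).2,
        hs.swap⟩
  · rintro ⟨h1, h2⟩ k d v hv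
    let x : Fin k → Homog ℋ := fun i => ⟨d i, v i, hv i⟩
    refine ⟨?_, fun σ => ?_⟩
    · have := h1 (List.ofFn x)
      rwa [onLists_ofFn, deg_ofFn] at this
    · have := h2.isPermSymm k x σ
      rwa [onLists_ofFn, onLists_ofFn] at this

/-- Since H is the direct sum of its components, multilinear maps are determined by homogeneous
arguments. Identities of families may therefore be checked on lists. -/
theorem onLists_injective [DirectSum.Decomposition ℋ] {F F' : Family K H W}
    (h : onLists ℋ F = onLists ℋ F') : F = F' := by
  funext k
  let e := DirectSum.decomposeLinearEquiv ℋ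
  suffices (F k).compLinearMap (fun _ => e.symm.toLinearMap) =
      (F' k).compLinearMap (fun _ => e.symm.toLinearMap) by
    ext v
    have := congrArg (fun G => G fun i => e (v i)) this
    simpa using this
  refine MultilinearMap.dfinsupp_ext fun d => ?_
  ext v
  have := congrFun h (List.ofFn fun i => (⟨d i, v i⟩ : Homog ℋ))
  rw [onLists_ofFn, onLists_ofFn] at this
  have he : ∀ i, e.symm (DFinsupp.single (β := fun n => ℋ n) (d i) (v i)) = v i := fun i =>
    DirectSum.decompose_symm_of ℋ (v i)
  simpa [he] using this

end Families

/-! ### The brackets and differentials in terms of lists -/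

section Bridge

variable {K H W : Type*} [Field K] [AddCommGroup H] [Module K H] [AddCommGroup W] [Module K W]
  {ℋ : ℤ → Submodule K H} {𝒲 : ℤ → Submodule K W}

theorem take_ofFn {X : Type*} {p l : ℕ} (h : l ≤ p) (y : Fin p → X) :
    (List.ofFn y).take l = List.ofFn fun i : Fin l => y ⟨i, by omega⟩ := by
  apply List.ext_getElem
  · simp [h]
  · intro n h1 h2
    simp

theorem drop_ofFn {X : Type*} {p l r : ℕ} (h : l + r = p) (y : Fin p → X) :
    (List.ofFn y).drop l = List.ofFn fun i : Fin r => y ⟨l + i, by omega⟩ := by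
  apply List.ext_getElem
  · simp; omega
  · intro n h1 h2
    simp

theorem sum_pairTerm (b : ℤ → ℤ → W →ₗ[K] W →ₗ[K] W) (m n : ℤ) (F G : Family K H W) {p : ℕ}
    (x : Fin p → Homog ℋ) :
    ∑ l : Fin (p + 1), ∑ σ ∈ shuffles p l,
      ((-1 : K) ^ (n * ∑ i : Fin l, (x (σ ⟨i, by omega⟩)).1) *
        koszulSign K σ fun i => (x i).1) •
      b (m + ∑ i : Fin l, (x (σ ⟨i, by omega⟩)).1)
        (n + ∑ i : Fin (p - l), (x (σ ⟨l + i, by omega⟩)).1)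
        (F l fun i : Fin l => (x (σ ⟨i, by omega⟩)).2)
        (G (p - l) fun i : Fin (p - l) => (x (σ ⟨l + i, by omega⟩)).2) =
      prod b m n (onLists ℋ F) (onLists ℋ G) (List.ofFn x) := by
  rw [← unshuffle_eq_prod, ← sum_shuffles]
  refine Finset.sum_congr rfl fun l _ => Finset.sum_congr rfl fun σ _ => ?_
  rw [take_ofFn l.is_le, drop_ofFn (r := p - l) (by omega), onLists_ofFn, onLists_ofFn,
    deg_ofFn, deg_ofFn, mul_comm, mul_smul, listSign]

variable [DirectSum.Decomposition ℋ]

theorem insertSum_apply {a : W →ₗ[K] Module.End K H}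
    (ha : ∀ {i j x y}, x ∈ 𝒲 i → y ∈ ℋ j → a x y ∈ ℋ (i + j + 1)) {Z : Type*} [AddCommGroup Z]
    [Module K Z] {F : Family K H Z} (hF : IsSymMultilinear (onLists ℋ F)) {n : ℤ}
    {G : Family K H W} (hG : HasDeg 𝒲 n (onLists ℋ G)) {p : ℕ} (x : Fin p → Homog ℋ) :
    insertSum a F G p (fun i => (x i).1) (fun i => (x i).2) =
      ins (n + 1) (vectorField a n (onLists ℋ G)) (onLists ℋ F) (List.ofFn x) := by
  rw [← unshuffle₃_eq_ins a hF, ← sum_shuffles₃, insertSum]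
  simp only [_root_.sum_apply, smul_apply]
  refine Finset.sum_congr rfl fun l _ => Finset.sum_congr rfl fun σ _ => ?_
  rw [insertTerm_apply, listSign]
  congr 1
  have hdrop : (List.ofFn fun i => x (σ i)).drop l = x (σ l) ::
      List.ofFn fun i : Fin (p - 1 - l) => x (σ ⟨l + 1 + i, by omega⟩) := by
    rw [List.drop_eq_getElem_cons (by simp), drop_ofFn (r := p - 1 - l) (by omega)]
    simp
  -- The inserted vector already has the degree to which `homogPart` projects, so the projection
  -- does not change it.
  have hmem := ha (hG ((List.ofFn fun i => x (σ i)).take l)) (x (σ l)).2.2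
  rw [hdrop, insertValue, onLists_cons_ofFn, show n + 1 + deg ((List.ofFn fun i => x (σ i)).take l)
    + (x (σ l)).1 = n + deg ((List.ofFn fun i => x (σ i)).take l) + (x (σ l)).1 + 1 by ring,
    homogPart_of_mem hmem]
  have hG' : onLists ℋ G ((List.ofFn fun i => x (σ i)).take l) =
      G l fun i : Fin l => (x (σ ⟨i, by omega⟩)).2 := by
    rw [take_ofFn l.is_lt.le, onLists_ofFn]
  rw [← hG']

theorem onLists_differential [CharZero K] (𝔥 : SymGradedLie K ℋ) (n : ℤ) {F : Family K H W}
    (hF : IsSymMultilinear (onLists ℋ F)) :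
    onLists ℋ (differential 𝔥 n F) = cochainDiff 𝔥 n (onLists ℋ F) := by
  funext l
  rw [cochainDiff, Pi.smul_apply, ← pickTwo_eq_ins 𝔥 hF]
  obtain ⟨p, x, rfl⟩ : ∃ (p : ℕ) (x : Fin p → Homog ℋ), l = List.ofFn x :=
    ⟨_, _, (List.ofFn_get l).symm⟩
  rw [onLists_ofFn]
  match p with
  | 0 => simp [pickTwo, differential]
  | 1 => simp [pickTwo, pickOne, differential]
  | q + 2 =>
    rw [differential, ofHomogeneous_apply ℋ _ (fun i => (x i).1) _ fun i => (x i).2.2,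
      ← sum_pickTwo]
    simp only [_root_.sum_apply, Finset.smul_sum]
    refine Finset.sum_congr rfl fun i _ => Finset.sum_congr rfl fun j _ => ?_
    split_ifs with hij
    · rw [smul_apply, zpow_smul_smul, onLists_cons_ofFn,
        show 1 + (x i.castSucc).1 + (x j).1 = (x i.castSucc).1 + (x j).1 + 1 by ring,
        homogPart_of_mem (𝔥.bracket_mem (x i.castSucc).2.2 (x j).2.2)]
      simp only [← add_assoc]
      rfl
    · simp

variable {b : ℤ → ℤ → W →ₗ[K] W →ₗ[K] W} {𝔥 : SymGradedLie K ℋ} {a : W →ₗ[K] Module.End K H}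

/-- The common shape of the two shuffle formulas; for each of them only the sign of the last sum
remains to be compared. -/
theorem onLists_eq_cochainBracket (ha : IsGradedAction 𝒲 b 𝔥 a) {m n : ℤ} {F G B : Family K H W}
    (hF : F ∈ symHom ℋ 𝒲 m) (hG : G ∈ symHom ℋ 𝒲 n)
    (hB : ∀ (p : ℕ) (x : Fin p → Homog ℋ), B p (fun i => (x i).2) =
      -insertSum a F G p (fun i => (x i).1) (fun i => (x i).2)
      + (-1 : K) ^ ((m + 1) * (n + 1)) • insertSum a G F p (fun i => (x i).1) (fun i => (x i).2)
      - (-1 : K) ^ (m + 1) • ∑ l : Fin (p + 1), ∑ σ ∈ shuffles p l,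
        ((-1 : K) ^ (n * ∑ i : Fin l, (x (σ ⟨i, by omega⟩)).1) *
          koszulSign K σ fun i => (x i).1) •
        b (m + ∑ i : Fin l, (x (σ ⟨i, by omega⟩)).1)
          (n + ∑ i : Fin (p - l), (x (σ ⟨l + i, by omega⟩)).1)
          (F l fun i : Fin l => (x (σ ⟨i, by omega⟩)).2)
          (G (p - l) fun i : Fin (p - l) => (x (σ ⟨l + i, by omega⟩)).2)) :
    onLists ℋ B = cochainBracket b a m n (onLists ℋ F) (onLists ℋ G) := by
  obtain ⟨hF, hF'⟩ := mem_symHom_iff.1 hF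
  obtain ⟨hG, hG'⟩ := mem_symHom_iff.1 hG
  funext l
  obtain ⟨p, x, rfl⟩ : ∃ (p : ℕ) (x : Fin p → Homog ℋ), l = List.ofFn x :=
    ⟨_, _, (List.ofFn_get l).symm⟩
  rw [onLists_ofFn, hB, sum_pairTerm, insertSum_apply ha.mem hF' hG, insertSum_apply ha.mem hG' hF]
  rfl

/-- A differential graded Lie algebra of cochains with values in a graded Lie structure which acts
on `𝔥`. -/
theorem isDGLA_of_onLists_bracket [CharZero K] (hb : IsGradedLie 𝒲 b)
    (ha : IsGradedAction 𝒲 b 𝔥 a) {L : DGLieData K (Family K H W)}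
    (hcomp : ∀ n, L.comp n = symHom ℋ 𝒲 (n - 1)) (hdiff : ∀ n, L.diff n = differential 𝔥 (n - 1))
    (hbr : ∀ {m n F G}, F ∈ L.comp m → G ∈ L.comp n → onLists ℋ (L.bracket m n F G) =
      cochainBracket b a (m - 1) (n - 1) (onLists ℋ F) (onLists ℋ G)) : L.IsDGLA := by
  have hmem : ∀ {n F}, F ∈ L.comp n →
      HasDeg 𝒲 (n - 1) (onLists ℋ F) ∧ IsSymMultilinear (onLists ℋ F) := fun {n F} h => by
    rw [hcomp] at h
    exact mem_symHom_iff.1 h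
  have hd : ∀ {n F}, F ∈ L.comp n →
      onLists ℋ (L.diff n F) = cochainDiff 𝔥 (n - 1) (onLists ℋ F) := fun {n F} h => by
    rw [hdiff, onLists_differential 𝔥 _ (hmem h).2]
  have bracket_mem : ∀ {m n F G}, F ∈ L.comp m → G ∈ L.comp n →
      L.bracket m n F G ∈ L.comp (m + n) := by
    intro m n F G hF hG
    rw [hcomp, mem_symHom_iff, hbr hF hG]
    refine ⟨?_, (hmem hF).2.cochainBracket (hmem hG).2⟩
    have := (hmem hF).1.cochainBracket hb a (hmem hG).1
    rwa [show m - 1 + (n - 1) + 1 = m + n - 1 by ring] at this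
  have diff_mem : ∀ {n F}, F ∈ L.comp n → L.diff n F ∈ L.comp (n + 1) := by
    intro n F hF
    rw [hcomp, mem_symHom_iff, hd hF]
    refine ⟨?_, (hmem hF).2.cochainDiff 𝔥⟩
    have := (hmem hF).1.cochainDiff 𝔥
    rwa [show n - 1 + 1 = n + 1 - 1 by ring] at this
  refine
    { bracket_mem := bracket_mem
      diff_mem := diff_mem
      bracket_add_left := fun {m n F F' G} hF hF' hG => onLists_injective (ℋ := ℋ) ?_
      bracket_smul_left := fun {m n} c {F G} hF hG => onLists_injective (ℋ := ℋ) ?_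
      bracket_add_right := fun {m n F G G'} hF hG hG' => onLists_injective (ℋ := ℋ) ?_
      bracket_smul_right := fun {m n} c {F G} hF hG => onLists_injective (ℋ := ℋ) ?_
      bracket_skew := fun {m n F G} hF hG => onLists_injective (ℋ := ℋ) ?_
      jacobi := fun {m n k F G E} hF hG hE => onLists_injective (ℋ := ℋ) ?_
      diff_add := fun {n F F'} hF hF' => onLists_injective (ℋ := ℋ) ?_
      diff_smul := fun {n} c {F} hF => onLists_injective (ℋ := ℋ) ?_
      diff_diff := fun {n F} hF => onLists_injective (ℋ := ℋ) ?_
      diff_bracket := fun {m n F G} hF hG => onLists_injective (ℋ := ℋ) ?_ }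
  · rw [onLists_add, hbr (add_mem hF hF') hG, hbr hF hG, hbr hF' hG, onLists_add]
    simp only [cochainBracket, ins_add_right, vectorField_add, (hmem hG).2.ins_add_left,
      prod_add_left]
    module
  · rw [onLists_smul, hbr (Submodule.smul_mem _ c hF) hG, hbr hF hG, onLists_smul]
    simp only [cochainBracket, ins_smul_right, vectorField_smul, (hmem hG).2.ins_smul_left,
      prod_smul_left]
    module
  · rw [onLists_add, hbr hF (add_mem hG hG'), hbr hF hG, hbr hF hG', onLists_add]
    simp only [cochainBracket, ins_add_right, vectorField_add, (hmem hF).2.ins_add_left,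
      prod_add_right]
    module
  · rw [onLists_smul, hbr hF (Submodule.smul_mem _ c hG), hbr hF hG, onLists_smul]
    simp only [cochainBracket, ins_smul_right, vectorField_smul, (hmem hF).2.ins_smul_left,
      prod_smul_right]
    module
  · have h := cochainBracket_skew (a := a) hb (hmem hF).1 (hmem hG).1
    -- The suspension shift: with (m - 1) + 1 = m the sign exponents (m+1)(n+1) of cochains become
    -- the usual mn.
    rw [sub_add_cancel, sub_add_cancel] at h
    rw [← neg_one_smul K, onLists_smul, onLists_smul, hbr hF hG, hbr hG hF, h, neg_one_smul]
  · have h := cochainBracket_jacobi hb ha (hmem hF).1 (hmem hG).1 (hmem hE).1 (hmem hF).2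
      (hmem hG).2 (hmem hE).2
    rw [onLists_add, onLists_smul, hbr hF (bracket_mem hG hE), hbr hG hE,
      hbr (bracket_mem hF hG) hE, hbr hF hG, hbr hG (bracket_mem hF hE), hbr hF hE]
    rw [sub_add_cancel, sub_add_cancel, show n - 1 + (k - 1) + 1 = n + k - 1 by ring,
      show m - 1 + (n - 1) + 1 = m + n - 1 by ring,
      show m - 1 + (k - 1) + 1 = m + k - 1 by ring] at h
    exact h
  · rw [onLists_add, hd (add_mem hF hF'), hd hF, hd hF', onLists_add, cochainDiff, ins_add_right,
      smul_add]
    rfl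
  · rw [onLists_smul, hd (Submodule.smul_mem _ c hF), hd hF, onLists_smul, cochainDiff,
      ins_smul_right, smul_comm]
    rfl
  · have h := cochainDiff_cochainDiff 𝔥 (n := n - 1) (hmem hF).2
    rw [hd (diff_mem hF), hd hF, show n + 1 - 1 = n - 1 + 1 by ring, h]
    rfl
  · have h := cochainDiff_cochainBracket ha (hmem hF).1 (hmem hG).1 (hmem hF).2 (hmem hG).2
    rw [onLists_add, onLists_smul, hd (bracket_mem hF hG), hbr hF hG, hbr (diff_mem hF) hG,
      hbr hF (diff_mem hG), hd hF, hd hG, show m + 1 - 1 = m - 1 + 1 by ring,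
      show n + 1 - 1 = n - 1 + 1 by ring, show m + n - 1 = m - 1 + (n - 1) + 1 by ring, h,
      sub_add_cancel]

end Bridge

/-! ### The two differential graded Lie algebras -/

section Main

variable {K G H : Type*} [Field K] [AddCommGroup G] [Module K G] [AddCommGroup H] [Module K H]
  {𝒢 : ℤ → Submodule K G} {ℋ : ℤ → Submodule K H}

/-- The bracket `[s⁻¹D, s⁻¹E] = (-1)^D s⁻¹[D, E]` of `s⁻¹Der(𝔥)`, where `s⁻¹D` and `s⁻¹E` have
degrees `i` and `j`. -/
def desuspBracket (K H : Type*) [Field K] [AddCommGroup H] [Module K H] (i j : ℤ) :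
    Module.End K H →ₗ[K] Module.End K H →ₗ[K] Module.End K H :=
  (-1 : K) ^ (i + 1) • gradedCommutator K H (i + 1) (j + 1)

theorem desuspBracket_apply (i j : ℤ) (D E : Module.End K H) :
    desuspBracket K H i j D E =
      (-1 : K) ^ (i + 1) • (D * E - (-1 : K) ^ ((i + 1) * (j + 1)) • (E * D)) := by
  simp [desuspBracket, gradedCommutator]

theorem gradedCommutator_mem_der (𝔥 : SymGradedLie K ℋ) {m n : ℤ} {D E : Module.End K H}
    (hD : D ∈ der 𝔥 m) (hE : E ∈ der 𝔥 n) : gradedCommutator K H m n D E ∈ der 𝔥 (m + n) := by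
  have e : gradedCommutator K H m n D E = D * E - (-1 : K) ^ (m * n) • (E * D) := by
    simp [gradedCommutator]
  rw [e]
  obtain ⟨hD1, hD2⟩ := hD
  obtain ⟨hE1, hE2⟩ := hE
  refine ⟨fun i x hx => ?_, fun i j x hx y hy => ?_⟩
  · have h1 := hD1 _ _ (hE1 i x hx)
    have h2 := hE1 _ _ (hD1 i x hx)
    rw [add_assoc, add_comm n m] at h1
    rw [add_assoc] at h2
    exact sub_mem h1 (Submodule.smul_mem _ _ h2)
  · simp only [LinearMap.sub_apply, LinearMap.smul_apply, Module.End.mul_apply, hD2 i j x hx y hy,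
      hE2 i j x hx y hy, map_add, map_smul, hD2 _ _ _ (hE1 i x hx) y hy,
      hD2 _ _ x hx _ (hE1 j y hy), hE2 _ _ _ (hD1 i x hx) y hy, hE2 _ _ x hx _ (hD1 j y hy),
      map_sub, LinearMap.sub_apply]
    simp only [negOne_zpow]
    cases hm : odd m <;> cases hn : odd n <;> cases hi : odd i <;> simp [hm, hn, hi] <;> abel

theorem isGradedLie_desuspDer (𝔥 : SymGradedLie K ℋ) :
    IsGradedLie (desuspDer 𝔥) (desuspBracket K H) where
  mem {i j D E} hD hE := by
    have := gradedCommutator_mem_der 𝔥 hD hE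
    rw [show i + 1 + (j + 1) = i + j + 1 + 1 by ring] at this
    exact Submodule.smul_mem _ _ this
  symm {i j D E} _ _ := by
    simp only [desuspBracket_apply, negOne_zpow]
    cases hi : odd i <;> cases hj : odd j <;> simp [hi, hj] <;> abel
  leibniz {i j k D E F} _ _ _ := by
    simp only [desuspBracket_apply, negOne_zpow]
    cases hi : odd i <;> cases hj : odd j <;> cases hk : odd k <;>
      simp [hi, hj, hk, mul_add, add_mul, mul_sub, sub_mul, mul_assoc] <;> abel

theorem isGradedAction_desuspDer (𝔥 : SymGradedLie K ℋ) :
    IsGradedAction (desuspDer 𝔥) (desuspBracket K H) 𝔥 LinearMap.id where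
  mem {i j D y} hD hy := by
    have := hD.1 j y hy
    rwa [← add_assoc, add_comm j i] at this
  derivation {i j k D y z} hD hy hz := hD.2 j k y hy z hz
  comp {i j k D E z} _ _ _ := by
    simp only [LinearMap.id_apply, desuspBracket_apply, LinearMap.smul_apply, LinearMap.sub_apply,
      Module.End.mul_apply, negOne_zpow]
    cases hi : odd i <;> cases hj : odd j <;> simp [hi, hj]

/-- The tautological action of s⁻¹Der(𝔥), pulled back along ρ. -/
theorem IsAction.isGradedAction {𝔤 : SymGradedLie K 𝒢} {𝔥 : SymGradedLie K ℋ}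
    {ρ : G →ₗ[K] Module.End K H} (hρ : IsAction 𝔤 𝔥 ρ) :
    IsGradedAction 𝒢 (fun _ _ => 𝔤.bracket) 𝔥 ρ where
  mem hx hy := (isGradedAction_desuspDer 𝔥).mem (hρ.map_mem hx) hy
  derivation hx hy hz := (isGradedAction_desuspDer 𝔥).derivation (hρ.map_mem hx) hy hz
  comp hx hy hz := by
    rw [hρ.map_bracket hx hy]
    exact (isGradedAction_desuspDer 𝔥).comp (hρ.map_mem hx) (hρ.map_mem hy) hz

variable [DirectSum.Decomposition ℋ]

theorem onLists_actionBracket {𝔤 : SymGradedLie K 𝒢} {𝔥 : SymGradedLie K ℋ}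
    {ρ : G →ₗ[K] Module.End K H} (hρ : IsAction 𝔤 𝔥 ρ) {m n : ℤ} {F E : Family K H G}
    (hF : F ∈ symHom ℋ 𝒢 m) (hE : E ∈ symHom ℋ 𝒢 n) :
    onLists ℋ (actionBracket 𝔤 ℋ ρ m n F E) =
      cochainBracket (fun _ _ => 𝔤.bracket) ρ m n (onLists ℋ F) (onLists ℋ E) := by
  refine onLists_eq_cochainBracket hρ.isGradedAction hF hE fun p x => ?_
  rw [actionBracket, ofHomogeneous_apply ℋ _ (fun i => (x i).1) _ fun i => (x i).2.2]
  simp only [add_apply, sub_apply, neg_apply, smul_apply, _root_.sum_apply,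
    Finset.smul_sum]
  congr 1
  refine Finset.sum_congr rfl fun l _ => Finset.sum_congr rfl fun σ _ => ?_
  rw [pairTerm_apply, smul_smul, ← mul_assoc, ← zpow_add₀ (neg_ne_zero.2 one_ne_zero)]
  congr 3
  ring

theorem onLists_derBracket (𝔥 : SymGradedLie K ℋ) {m n : ℤ} {F E : Family K H (Module.End K H)}
    (hF : F ∈ symHom ℋ (desuspDer 𝔥) m) (hE : E ∈ symHom ℋ (desuspDer 𝔥) n) :
    onLists ℋ (derBracket ℋ m n F E) =
      cochainBracket (desuspBracket K H) LinearMap.id m n (onLists ℋ F) (onLists ℋ E) := by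
  refine onLists_eq_cochainBracket (isGradedAction_desuspDer 𝔥) hF hE fun p x => ?_
  rw [derBracket, ofHomogeneous_apply ℋ _ (fun i => (x i).1) _ fun i => (x i).2.2]
  simp only [add_apply, sub_apply, neg_apply, smul_apply, _root_.sum_apply,
    Finset.smul_sum]
  congr 1
  refine Finset.sum_congr rfl fun l _ => Finset.sum_congr rfl fun σ _ => ?_
  rw [pairTerm_apply, desuspBracket, LinearMap.smul_apply, LinearMap.smul_apply, smul_smul,
    smul_smul]
  congr 1
  -- With s the degree of the arguments of α, desuspension gives (-1)^(m+s+1), and m + 1 + ns + m +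
  -- s + 1 has the parity of (n+1)s.
  generalize (∑ i : Fin l, (x (σ ⟨i, by omega⟩)).1) = s
  simp only [negOne_zpow]
  cases hm : odd m <;> cases hn : odd n <;> cases hs : odd s <;> simp [hm, hn, hs]

theorem onLists_Psi (ρ : G →ₗ[K] Module.End K H) (F : Family K H G) :
    onLists ℋ (Psi ρ F) = ρ ∘ onLists ℋ F := rfl

theorem HasDeg.comp {𝔤 : SymGradedLie K 𝒢} {𝔥 : SymGradedLie K ℋ} {ρ : G →ₗ[K] Module.End K H}
    (hρ : IsAction 𝔤 𝔥 ρ) {n : ℤ} {f : List (Homog ℋ) → G} (hf : HasDeg 𝒢 n f) :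
    HasDeg (desuspDer 𝔥) n (ρ ∘ f) := fun l => hρ.map_mem (hf l)

theorem IsSymMultilinear.comp {W U : Type*} [AddCommGroup W] [Module K W] [AddCommGroup U]
    [Module K U] (φ : W →ₗ[K] U) {f : List (Homog ℋ) → W} (hf : IsSymMultilinear f) :
    IsSymMultilinear (φ ∘ f) where
  add l l' i x y := by simp [hf.add]
  smul l l' i c x := by simp [hf.smul]
  swap l l' a b := by rw [Function.comp_apply, hf.swap, map_smul]; rfl

end Main

end HomotopyLie

/-! ### The homomorphism induced by the action -/

theorem mainTheorem5 {K G H : Type*} [Field K] [CharZero K]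
    [AddCommGroup G] [Module K G] [AddCommGroup H] [Module K H]
    {𝒢 : ℤ → Submodule K G} [DirectSum.Decomposition 𝒢]
    {ℋ : ℤ → Submodule K H} [DirectSum.Decomposition ℋ]
    (𝔤 : HomotopyLie.SymGradedLie K 𝒢) (𝔥 : HomotopyLie.SymGradedLie K ℋ)
    (ρ : G →ₗ[K] Module.End K H) (hρ : HomotopyLie.IsAction 𝔤 𝔥 ρ) :
    HomotopyLie.IsDGLAHom (HomotopyLie.actionDGLie 𝔤 𝔥 ρ) (HomotopyLie.derDGLie 𝔥)
      (HomotopyLie.Psi ρ) := by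
  open HomotopyLie in
  have hmem : ∀ {n : ℤ} {F : Family K H G}, F ∈ symHom ℋ 𝒢 n →
      Psi ρ F ∈ symHom ℋ (desuspDer 𝔥) n := fun {n F} hF => by
    rw [mem_symHom_iff] at hF ⊢
    exact ⟨hF.1.comp hρ, hF.2.comp ρ⟩
  exact
    { source := isDGLA_of_onLists_bracket 𝔤.isGradedLie hρ.isGradedAction (fun _ => rfl)
        (fun _ => rfl) (onLists_actionBracket hρ)
      target := isDGLA_of_onLists_bracket (isGradedLie_desuspDer 𝔥) (isGradedAction_desuspDer 𝔥)
        (fun _ => rfl) (fun _ => rfl) (onLists_derBracket 𝔥)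
      map_mem := hmem
      map_bracket := fun {m n F E} hF hE => onLists_injective (ℋ := ℋ) (by
        refine Eq.trans ?_ (onLists_derBracket 𝔥 (hmem hF) (hmem hE)).symm
        rw [onLists_Psi, onLists_Psi, onLists_Psi]
        refine (congrArg _ (onLists_actionBracket hρ hF hE)).trans ?_
        exact comp_cochainBracket (b := fun _ _ => 𝔤.bracket) (b' := desuspBracket K H)
          (a := ρ) (a' := LinearMap.id) ρ hρ.map_bracket rfl (mem_symHom_iff.1 hF).1
          (mem_symHom_iff.1 hE).1)
      map_diff := fun {n F} hF => onLists_injective (ℋ := ℋ) (by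
        refine Eq.trans ?_ (onLists_differential 𝔥 _ (mem_symHom_iff.1 (hmem hF)).2).symm
        rw [onLists_Psi, onLists_Psi]
        refine (congrArg _ (onLists_differential 𝔥 _ (mem_symHom_iff.1 hF).2)).trans ?_
        exact comp_cochainDiff 𝔥 ρ _ _) }
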